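/- Let $f:[0,1]\to[0,1]$ be measurable and preserve a Borel probability measure $\mu$ that is absolutely continuous with respect to Lebesgue measure. Suppose that, for some Banach space $\mathcal C\subset L^1(\mu)$ of real-valued measurable functions, there is summable decay of correlations for observables in $\mathcal C$ against $L^1(\mu)$: there are $\rho_n>0$ ($n\ge1$) with $\sum_{n\ge 1}\rho_n<\infty$ such that for all $\phi\in\mathcal C$, $\psi\in L^1(\mu)$ and $n\ge1$ the function $\phi\cdot(\psi\circ f^n)$ is integrable and $$\Big|\int \phi\,(\psi\circ f^n)\,d\mu-\int\phi\,d\mu\int\psi\,d\mu\Big|\le\rho_n\|\phi\|_{\mathcal C}\|\psi\|_{L^1(\mu)} .$$ Let $\mathcal Z_1,\dots,\mathcal Z_d\subset[0,1]$ be finite non-empty sets such that, in a neighbourhood of each of their points, $f$ is continuous and $\mu$ has a density that is continuous with values in $(0,\infty)$. Let $\psi_j(x)=g_j(\operatorname{dist}(x,\mathcal Z_j))$, where each $g_j$ is one of $g(t)=-\log t$, $g(t)=t^{-1/\alpha}$ (both with $g(0)=+\infty$), $g(t)=D-t^{1/\alpha}$, with $\alpha>0$, $D\in\mathbb R$ (possibly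 depending on $j$). Put $X_{nj}=\psi_j\circ f^n$ and $M_{nj}=\max_{0\le i<n}X_{ij}$, and write $\mathbb X_n,\mathbb M_n$ for the corresponding vectors; inequalities between vectors are componentwise. For $\tau\in[0,\infty)^d\setminus\{0\}$, a sequence $u_n(\tau)=(u_{n1},\dots,u_{nd})\in\mathbb R^d$ is called normalising if $n\,\mu(X_{0j}>u_{nj})\to\tau_j$ for every $j$. Given such a sequence, let $A_n^{(q)}=\{\mathbb X_0\not\le u_n,\ \mathbb X_1\le u_n,\dots,\mathbb X_q\le u_n\}$ for $q\ge 0$ (so $A_n^{(0)}=\{\mathbb X_0\not\le u_n\}$), and for measurable $A,B$ let $R(A)=\inf_{x\in A}\inf\{j\ge1: f^j(x)\in A\}$ and $\mathscr W_{s,\ell}(B)=\bigcap_{i=s}^{s+\max\{\ell-1,0\}}f^{-i}(B^c)$. Then there is a function $\hat\Gamma$ such that for every $\tau\in[0,\infty)^d\setminus\{0\}$: (a) normalising sequences exist, and every normalising sequence $u_n(\tau)$ satisfies $\lim_{n\to\infty} n\,\mu(\mathbb X_0\not\le u_n(\tau))=\hat\Gamma(\tau)$. (b) Let $u_n(\tau)$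 be a normalising sequence for which the limit $\theta(\tau)=\lim_{q\to\infty}\lim_{n\to\infty}\mu(A_n^{(q)})/\mu(A_n^{(0)})$ is well defined. Assume that $p=\min\{j\ge0:\lim_{n\to\infty}R(A_n^{(j)})=\infty\}$ exists and that the indicator functions of $A_n^{(p)}$, $n\ge1$, belong to $\mathcal C$ with uniformly bounded $\mathcal C$-norms. Then the following two conditions hold, with common integers $t_n=t_n^{(q)}\ge1$ satisfying $t_n^{(q)}=o(n)$ for each $q\ge 0$. - (Mixing.) There is $\gamma(q,n,t)$, decreasing in $t$, with $\lim_{q\to\infty}\limsup_{n\to\infty}n\gamma(q,n,t_n^{(q)})=0$ and, for all $\ell,t,n\ge1$ and $q\ge0$, $$\big|\mu(A_n^{(q)}\cap\mathscr W_{t,\ell}(A_n^{(q)}))-\mu(A_n^{(q)})\,\mu(\mathscr W_{0,\ell}(A_n^{(q)}))\big|\le\gamma(q,n,t).$$ - (Cluster separation.) There are integers $k_n\to\infty$ with $k_nt_n^{(q)}=o(n)$ for each $q$ and $$\lim_{q\to\infty}\limsup_{n\to\infty}\ n\sum_{j=q+1}^{\lfloor n/k_n\rfloor-1}\mu\big(A_n^{(q)}\cap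 f^{-j}(A_n^{(q)})\big)=0 .$$ Moreover $$\lim_{n\to\infty}\mu(\mathbb M_n\le u_n(\tau))=e^{-\theta(\tau)\hat\Gamma(\tau)} .$$ -/

import Mathlib

open MeasureTheory Filter Topology Set
open scoped ENNReal unitInterval

namespace MultivariateExtremes

noncomputable section

/-! ### Observables -/

/-- The three standard types of function `g` of the distance to the maximal set:
`-log t`, `t ^ (-1/α)` and `D - t ^ (1/α)`, where `α > 0` and `D ∈ ℝ`. -/
inductive ObservableType where
  | log : ObservableType
  | power (α : ℝ) (hα : 0 < α) : ObservableType
  | bounded (D α : ℝ) (hα : 0 < α) : ObservableType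

/-- The function `g` of the given type, for arguments `t ≥ 0`; the first two types take the value
`+∞` at `t = 0`. -/
def ObservableType.g : ObservableType → ℝ → EReal
  | .log, t => if t = 0 then ⊤ else ((-Real.log t : ℝ) : EReal)
  | .power α _, t => if t = 0 then ⊤ else ((t ^ (-1 / α) : ℝ) : EReal)
  | .bounded D α _, t => ((D - t ^ (1 / α) : ℝ) : EReal)

/-- The vector of observables `ψ_j(x) = g_j(dist(x, Z_j))`. -/
def observable {X : Type*} [PseudoMetricSpace X] {d : ℕ} (g : Fin d → ObservableType)
    (Z : Fin d → Finset X) (j : Fin d) (x : X) : EReal :=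
  (g j).g (Metric.infDist x (Z j : Set X))

section Exceedances

/-! ### The process `X_n = Ψ ∘ f^n`, its maxima and its exceedances

Throughout, `ψ j x` is the `j`-th component of the observable and `u n j` is the `j`-th component
of the `n`-th normalising vector. -/

variable {X : Type*} {d : ℕ}

/-- The componentwise maximum `M_{nj} = max_{0 ≤ i < n} ψ_j ∘ f^i`. -/
def partialMax (f : X → X) (ψ : Fin d → X → EReal) (n : ℕ) (j : Fin d) (x : X) : EReal :=
  (Finset.range n).sup fun i => ψ j (f^[i] x)

/-- The event `{M_n ≤ u_n}` (componentwise). -/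
def maxLE (f : X → X) (ψ : Fin d → X → EReal) (u : ℕ → Fin d → ℝ) (n : ℕ) : Set X :=
  {x | ∀ j, partialMax f ψ n j x ≤ (u n j : EReal)}

/-- The event `A_n^{(q)} = {X_0 ≰ u_n, X_1 ≤ u_n, …, X_q ≤ u_n}`. For `q = 0` it is
`{X_0 ≰ u_n}`: some component exceeds its level. -/
def exceedance (f : X → X) (ψ : Fin d → X → EReal) (u : ℕ → Fin d → ℝ) (q n : ℕ) : Set X :=
  {x | (∃ j, (u n j : EReal) < ψ j x) ∧
    ∀ i, 1 ≤ i → i ≤ q → ∀ j, ψ j (f^[i] x) ≤ (u n j : EReal)}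

/-- `W_{s,ℓ}(B) = ⋂_{i = s}^{s + max(ℓ - 1, 0)} f^{-i}(Bᶜ)`. -/
def noOccurrence (f : X → X) (s ℓ : ℕ) (B : Set X) : Set X :=
  ⋂ i ∈ Finset.Icc s (s + (ℓ - 1)), f^[i] ⁻¹' Bᶜ

/-- The first hitting time `r_A(x) = inf {j ≥ 1 : f^j(x) ∈ A}`, with `inf ∅ = ∞`. -/
def hittingTime (f : X → X) (A : Set X) (x : X) : ℕ∞ :=
  ⨅ (j : ℕ) (_ : 1 ≤ j ∧ f^[j] x ∈ A), (j : ℕ∞)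

/-- The first return `R(A) = inf_{x ∈ A} r_A(x)` from `A` to `A`. -/
def firstReturn (f : X → X) (A : Set X) : ℕ∞ :=
  ⨅ x ∈ A, hittingTime f A x

variable [MeasurableSpace X]

/-- `n μ(ψ_j > u_{nj}) → τ_j` for every component `j`. -/
def IsNormalising (μ : Measure X) (ψ : Fin d → X → EReal) (τ : Fin d → ℝ)
    (u : ℕ → Fin d → ℝ) : Prop :=
  ∀ j, Tendsto (fun n : ℕ => (n : ℝ) * μ.real {x | (u n j : EReal) < ψ j x}) atTop (𝓝 (τ j))

/-- `θ = lim_{q → ∞} lim_{n → ∞} μ(A_n^{(q)}) / μ(A_n^{(0)})`, both limits existing. -/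
def IsExtremalIndex (μ : Measure X) (f : X → X) (ψ : Fin d → X → EReal)
    (u : ℕ → Fin d → ℝ) (θ : ℝ) : Prop :=
  ∃ a : ℕ → ℝ,
    (∀ᶠ q in atTop, Tendsto
      (fun n => μ.real (exceedance f ψ u q n) / μ.real (exceedance f ψ u 0 n)) atTop (𝓝 (a q))) ∧
    Tendsto a atTop (𝓝 θ)

/-- The mixing condition on the levels `u`, realised with the gaps `t q n` (the sequence
`(t_n)_n = (t q n)_n` belongs to the index `q`). -/
def MixingCondition (μ : Measure X) (f : X → X) (ψ : Fin d → X → EReal)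
    (u : ℕ → Fin d → ℝ) (t : ℕ → ℕ → ℕ) : Prop :=
  ∃ γ : ℕ → ℕ → ℕ → ℝ,
    (∀ q n s ℓ : ℕ, 1 ≤ n → 1 ≤ s → 1 ≤ ℓ →
      |μ.real (exceedance f ψ u q n ∩ noOccurrence f s ℓ (exceedance f ψ u q n)) -
        μ.real (exceedance f ψ u q n) *
          μ.real (noOccurrence f 0 ℓ (exceedance f ψ u q n))| ≤ γ q n s) ∧
    (∀ q n, Antitone (γ q n)) ∧
    (∀ q n, 1 ≤ t q n) ∧
    (∀ q, Tendsto (fun n : ℕ => (t q n : ℝ) / n) atTop (𝓝 0)) ∧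
    Tendsto (fun q => limsup (fun n : ℕ => (((n : ℝ) * γ q n (t q n) : ℝ) : EReal)) atTop)
      atTop (𝓝 0)

/-- The cluster separation condition on the levels `u`, relative to the gaps `t q n`. The sum runs
over `q + 1 ≤ j ≤ ⌊n / k_n⌋ - 1`. -/
def ClusterSeparation (μ : Measure X) (f : X → X) (ψ : Fin d → X → EReal)
    (u : ℕ → Fin d → ℝ) (t : ℕ → ℕ → ℕ) : Prop :=
  ∃ k : ℕ → ℕ,
    Tendsto k atTop atTop ∧
    (∀ q, Tendsto (fun n : ℕ => ((k n : ℝ) * t q n) / n) atTop (𝓝 0)) ∧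
    Tendsto (fun q => limsup (fun n : ℕ => (n : ℝ≥0∞) *
        ∑ j ∈ Finset.Ico (q + 1) (n / k n),
          μ (exceedance f ψ u q n ∩ f^[j] ⁻¹' exceedance f ψ u q n)) atTop)
      atTop (𝓝 0)

/-! ### Decay of correlations -/

/-- Summable decay of correlations for observables in `C` against `L¹(μ)`. The Banach space `C` of
integrable functions is given with its own norm and the linear map `ι` that sends an element of `C`
to its class in `L¹(μ)` (so `C` may consist of functions or of classes of functions). -/
def SummableDecay (μ : Measure X) (f : X → X) {C : Type*} [NormedAddCommGroup C]
    [NormedSpace ℝ C] (ι : C →ₗ[ℝ] Lp ℝ 1 μ) : Prop :=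
  ∃ ρ : ℕ → ℝ, (∀ n, 1 ≤ n → 0 < ρ n) ∧ Summable ρ ∧
    ∀ (φ : C) (ψ : X → ℝ), Integrable ψ μ → ∀ n, 1 ≤ n →
      Integrable (fun x => ι φ x * ψ (f^[n] x)) μ ∧
      |∫ x, ι φ x * ψ (f^[n] x) ∂μ - (∫ x, ι φ x ∂μ) * ∫ x, ψ x ∂μ|
        ≤ ρ n * ‖φ‖ * ∫ x, |ψ x| ∂μ

/-- The indicator functions of the sets `A n`, `n ≥ 1`, belong to `C` and their norms in `C` are
uniformly bounded. -/
def BoundedIndicators (μ : Measure X) {C : Type*} [NormedAddCommGroup C]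
    [NormedSpace ℝ C] (ι : C →ₗ[ℝ] Lp ℝ 1 μ) (A : ℕ → Set X) : Prop :=
  ∃ K : ℝ, ∀ n, 1 ≤ n → ∃ φ : C,
    (⇑(ι φ) =ᵐ[μ] (A n).indicator fun _ => (1 : ℝ)) ∧ ‖φ‖ ≤ K

end Exceedances

end

end MultivariateExtremes

namespace MultivariateExtremes

/-! ### Sequences -/

/-! Write `E` for the event that some level is exceeded now, and `B = escape f E p` for the
exceedances followed by `p` quiet steps. Near a point of the maximal sets `μ` gives a ball of radius
`r` mass `L r + o(r)`, and `E` is a finite union of such balls, eventually disjoint; so `n μ(E)` has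
a limit that depends on `τ` only (`tendsto_nat_mul_exceedance_zero`).

The sets `B` have return times tending to infinity, and their indicators are bounded in `C`. Decay
against `L¹` bounds the correlation of `B` with any later event `G` by `ρ s * μ(G)`. Early returns
to `B` are thus excluded and late ones cost at most a tail of the summable rate, so the probability
of avoiding `B` up to time `n` is close to `(1 - μ(B)) ^ n` (`tendsto_avoid_exp`).

Three comparisons finish the proof. Avoiding `B` and avoiding `E` differ only through visits to `E`
in the last `p` steps (`avoid_zero_diff_subset`). A point of `B` that visits `E` again before it can
return to `B` must keep visiting `E` with gaps at most `p`, and a disjointness count makes this rare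
(`mul_measureReal_escape_inter_le`). Hence replacing `p` by a larger `q` changes `n μ(B)` by `o(1)`,
which identifies its limit as `θ` times the limit of `n μ(E)` and carries the mixing bound from `p`
to `q`. -/

theorem exists_tendsto_atTop_eventually {P : ℕ → ℕ → Prop} (hP : ∀ m, ∀ᶠ n in atTop, P m n) :
    ∃ m : ℕ → ℕ, Tendsto m atTop atTop ∧ ∀ᶠ n in atTop, P (m n) n := by
  classical
  -- Diagonal choice: the largest admissible `m ≤ n`. `findGreatest` returns `0` by default, so `P 0
  -- n` is needed for its value to be admissible.
  refine ⟨fun n => Nat.findGreatest (fun m => P m n) n, ?_, ?_⟩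
  · refine tendsto_atTop.2 fun M => ?_
    filter_upwards [hP M, eventually_ge_atTop M] with n h1 h2
    exact Nat.le_findGreatest h2 h1
  · filter_upwards [hP 0] with n h
    exact Nat.findGreatest_spec (P := fun m => P m n) (Nat.zero_le n) h

theorem tendsto_zero_of_tendsto_nat_mul {a : ℕ → ℝ} {s : ℝ}
    (hs : Tendsto (fun n : ℕ => (n : ℝ) * a n) atTop (𝓝 s)) : Tendsto a atTop (𝓝 0) := by
  have h := hs.mul (tendsto_inv_atTop_zero.comp (tendsto_natCast_atTop_atTop (R := ℝ)))
  rw [mul_zero] at h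
  refine h.congr' ?_
  filter_upwards [eventually_gt_atTop 0] with n hn
  have hn' : (n : ℝ) ≠ 0 := by exact_mod_cast hn.ne'
  simp only [Function.comp_apply]
  field_simp

/-- The running minimum of `ρ 1, …, ρ n`. -/
noncomputable def runningMin (ρ : ℕ → ℝ) : ℕ → ℝ
  | 0 => ρ 1
  | n + 1 => min (runningMin ρ n) (ρ (n + 1))

theorem runningMin_antitone (ρ : ℕ → ℝ) : Antitone (runningMin ρ) :=
  antitone_nat_of_succ_le fun _ => min_le_left _ _

theorem exists_runningMin_eq (ρ : ℕ → ℝ) {n : ℕ} (hn : 1 ≤ n) :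
    ∃ j, 1 ≤ j ∧ j ≤ n ∧ runningMin ρ n = ρ j := by
  induction n, hn using Nat.le_induction with
  | base => exact ⟨1, le_rfl, le_rfl, by simp [runningMin]⟩
  | succ n hn ih =>
    obtain ⟨j, h1, h2, h3⟩ := ih
    rcases min_choice (runningMin ρ n) (ρ (n + 1)) with h | h
    · exact ⟨j, h1, by omega, by rw [runningMin, h, h3]⟩
    · exact ⟨n + 1, by omega, le_rfl, by rw [runningMin, h]⟩

theorem runningMin_nonneg {ρ : ℕ → ℝ} (hρ : ∀ n, 1 ≤ n → 0 ≤ ρ n) (n : ℕ) :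
    0 ≤ runningMin ρ n := by
  induction n with
  | zero => exact hρ 1 le_rfl
  | succ n ih => exact le_min ih (hρ _ (by omega))

theorem runningMin_le (ρ : ℕ → ℝ) {n : ℕ} (hn : 1 ≤ n) : runningMin ρ n ≤ ρ n := by
  obtain ⟨m, rfl⟩ := Nat.exists_eq_add_of_le' hn
  exact min_le_right _ _

/-- By monotonicity, `n * r n` is at most twice the sum of `r` over the indices from `n / 2` to `n -
1`, which is dominated by a tail of the series. -/
theorem tendsto_nat_mul_of_antitone_of_summable {r : ℕ → ℝ} (hr : Antitone r)
    (h0 : ∀ n, 0 ≤ r n) (hs : Summable r) :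
    Tendsto (fun n : ℕ => (n : ℝ) * r n) atTop (𝓝 0) := by
  have htail : Tendsto (fun n : ℕ => 2 * ∑' k, r (k + n / 2)) atTop (𝓝 0) := by
    have h := (tendsto_sum_nat_add r).comp (Nat.tendsto_div_const_atTop (n := 2) (by norm_num))
    simpa using h.const_mul 2
  refine squeeze_zero (fun n => mul_nonneg n.cast_nonneg (h0 n)) (fun n => ?_) htail
  have h1 : ∑ k ∈ Finset.range (n - n / 2), r (k + n / 2) ≤ ∑' k, r (k + n / 2) :=
    ((summable_nat_add_iff (n / 2)).2 hs).sum_le_tsum _ fun _ _ => h0 _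
  have h2 : ((n - n / 2 : ℕ) : ℝ) * r n ≤ ∑ k ∈ Finset.range (n - n / 2), r (k + n / 2) := by
    have := Finset.card_nsmul_le_sum (Finset.range (n - n / 2)) (fun k => r (k + n / 2)) (r n)
      fun k hk => hr (by have := Finset.mem_range.1 hk; omega)
    simpa using this
  have h3 : (n : ℝ) ≤ 2 * ((n - n / 2 : ℕ) : ℝ) := by
    have : n ≤ 2 * (n - n / 2) := by omega
    exact_mod_cast this
  nlinarith [mul_le_mul_of_nonneg_right h3 (h0 n)]

theorem tendsto_nat_mul_runningMin {ρ : ℕ → ℝ} (hρ : ∀ n, 1 ≤ n → 0 ≤ ρ n) (hs : Summable ρ) :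
    Tendsto (fun n : ℕ => (n : ℝ) * runningMin ρ n) atTop (𝓝 0) := by
  refine tendsto_nat_mul_of_antitone_of_summable (runningMin_antitone ρ) (runningMin_nonneg hρ) ?_
  rw [← summable_nat_add_iff 1] at hs ⊢
  exact hs.of_nonneg_of_le (fun n => runningMin_nonneg hρ _) fun n => runningMin_le ρ (by omega)

/-- Gaps `t` and numbers of blocks `k` adapted to the mixing rate `r`. -/
theorem exists_gaps {r : ℕ → ℝ} (h0 : ∀ n, 0 ≤ r n)
    (hr : Tendsto (fun n : ℕ => (n : ℝ) * r n) atTop (𝓝 0)) :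
    ∃ t k : ℕ → ℕ, (∀ n, 1 ≤ t n) ∧ Tendsto k atTop atTop ∧
      Tendsto (fun n : ℕ => ((k n : ℝ) * t n) / n) atTop (𝓝 0) ∧
      Tendsto (fun n : ℕ => (t n : ℝ) / n) atTop (𝓝 0) ∧
      Tendsto (fun n : ℕ => (n : ℝ) * r (t n)) atTop (𝓝 0) := by
  have key : ∀ m : ℕ, ∀ᶠ n : ℕ in atTop, (m + 1) ^ 2 ≤ n ∧
      (n : ℝ) * r (n / (m + 1) ^ 2) ≤ 1 / ((m : ℝ) + 1) := by
    intro m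
    have hc : (m + 1) ^ 2 ≠ 0 := by positivity
    have hcR : (0 : ℝ) < 2 * ((m : ℝ) + 1) ^ 2 := by positivity
    have h1 := ((hr.const_mul (2 * ((m : ℝ) + 1) ^ 2)).comp (Nat.tendsto_div_const_atTop hc))
    rw [mul_zero] at h1
    filter_upwards [eventually_ge_atTop ((m + 1) ^ 2),
      h1.eventually (Iic_mem_nhds (by positivity : (0 : ℝ) < 1 / ((m : ℝ) + 1)))] with n hn hle
    refine ⟨hn, le_trans ?_ hle⟩
    have h2 : n ≤ 2 * (m + 1) ^ 2 * (n / (m + 1) ^ 2) := by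
      have h3 := Nat.div_add_mod n ((m + 1) ^ 2)
      have h4 := Nat.mod_lt n (Nat.pos_of_ne_zero hc)
      have h5 : (m + 1) ^ 2 ≤ (m + 1) ^ 2 * (n / (m + 1) ^ 2) :=
        Nat.le_mul_of_pos_right _ (Nat.div_pos hn (Nat.pos_of_ne_zero hc))
      rw [mul_assoc]
      omega
    have h2' : (n : ℝ) ≤ 2 * ((m : ℝ) + 1) ^ 2 * ((n / (m + 1) ^ 2 : ℕ) : ℝ) := by exact_mod_cast h2
    have := mul_le_mul_of_nonneg_right h2' (h0 (n / (m + 1) ^ 2))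
    simpa [mul_assoc] using this
  -- With `m = m n` growing slowly, the gap is `n / (m + 1) ^ 2` and the number of blocks is `m +
  -- 1`, so their product is at most `n / (m + 1)`. The `max` with `1` only affects finitely many
  -- `n`.
  obtain ⟨m, hm, hev⟩ := exists_tendsto_atTop_eventually key
  have hinv : Tendsto (fun n => 1 / ((m n : ℝ) + 1)) atTop (𝓝 0) :=
    tendsto_one_div_add_atTop_nhds_zero_nat.comp hm
  have ht : ∀ᶠ n in atTop, max 1 (n / (m n + 1) ^ 2) = n / (m n + 1) ^ 2 := by
    filter_upwards [hev] with n hn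
    exact max_eq_right (Nat.div_pos hn.1 (by positivity))
  have hkt : Tendsto (fun n : ℕ => (((m n + 1 : ℕ) : ℝ) * (max 1 (n / (m n + 1) ^ 2) : ℕ)) / n)
      atTop (𝓝 0) := by
    refine squeeze_zero' (Eventually.of_forall fun n => by positivity) ?_ hinv
    filter_upwards [ht, eventually_gt_atTop 0] with n hn hn0
    rw [hn]
    have hn0' : (0 : ℝ) < n := by exact_mod_cast hn0
    have h1 : ((m n + 1 : ℕ) : ℝ) ^ 2 * ((n / (m n + 1) ^ 2 : ℕ) : ℝ) ≤ n := by
      exact_mod_cast Nat.mul_div_le n ((m n + 1) ^ 2)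
    push_cast at h1 ⊢
    rw [div_le_div_iff₀ hn0' (by positivity)]
    nlinarith
  refine ⟨fun n => max 1 (n / (m n + 1) ^ 2), fun n => m n + 1, fun n => le_max_left _ _,
    (tendsto_add_atTop_nat 1).comp hm, hkt, ?_, ?_⟩
  · refine squeeze_zero (fun n => by positivity) (fun n => ?_) hkt
    gcongr
    push_cast
    exact le_mul_of_one_le_left (by positivity) (by linarith [(m n).cast_nonneg (α := ℝ)])
  · refine squeeze_zero' (Eventually.of_forall fun n => mul_nonneg n.cast_nonneg (h0 _)) ?_ hinv
    filter_upwards [ht, hev] with n hn hn'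
    rw [hn]
    exact hn'.2

/-! ### Escapes and avoidance -/

/-- The points of `E` that do not visit `E` at the times `1, …, q`. -/
def escape {X : Type*} (f : X → X) (E : Set X) (q : ℕ) : Set X :=
  {x | x ∈ E ∧ ∀ i, 1 ≤ i → i ≤ q → f^[i] x ∉ E}

/-- The points that avoid `B` at the times `s, …, s + ℓ - 1`. -/
def avoid {X : Type*} (f : X → X) (B : Set X) (s ℓ : ℕ) : Set X :=
  {x | ∀ i, i < ℓ → f^[s + i] x ∉ B}

section Sets

variable {X : Type*} {f : X → X}

theorem escape_anti (E : Set X) {p q : ℕ} (h : p ≤ q) : escape f E q ⊆ escape f E p :=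
  fun _ hx => ⟨hx.1, fun i h1 h2 => hx.2 i h1 (h2.trans h)⟩

theorem avoid_eq_preimage (B : Set X) (s ℓ : ℕ) : avoid f B s ℓ = f^[s] ⁻¹' avoid f B 0 ℓ := by
  ext x
  simp only [avoid, mem_ofPred_eq, mem_preimage, ← Function.iterate_add_apply, zero_add]
  simp only [add_comm]

theorem noOccurrence_eq_avoid (B : Set X) (s : ℕ) {ℓ : ℕ} (hℓ : 1 ≤ ℓ) :
    noOccurrence f s ℓ B = avoid f B s ℓ := by
  ext x
  simp only [noOccurrence, avoid, mem_iInter, mem_preimage, mem_compl_iff, mem_ofPred_eq,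
    Finset.mem_Icc]
  refine ⟨fun h i hi => h _ ⟨by omega, by omega⟩, fun h i hi => ?_⟩
  obtain ⟨j, rfl⟩ := Nat.exists_eq_add_of_le hi.1
  exact h j (by omega)

theorem avoid_zero_succ (B : Set X) (ℓ : ℕ) :
    avoid f B 0 (ℓ + 1) = f^[1] ⁻¹' avoid f B 0 ℓ \ (B ∩ avoid f B 1 ℓ) := by
  rw [← avoid_eq_preimage]
  ext x
  simp only [avoid, mem_ofPred_eq, Set.mem_sdiff, mem_inter_iff, zero_add]
  constructor
  · intro h
    exact ⟨fun i hi => by rw [add_comm]; exact h _ (by omega), fun h' => h 0 (by omega) h'.1⟩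
  · rintro ⟨h1, h2⟩ i hi
    rcases i with _ | i
    · exact fun h => h2 ⟨h, h1⟩
    · rw [add_comm]; exact h1 i (by omega)

/-- A last visit to `E` before time `n - p` would be followed by `p` steps off `E`, hence would be a
visit to the escape set. The proof runs this as a backward induction on the time. -/
theorem avoid_zero_diff_subset (E : Set X) (p n : ℕ) :
    avoid f (escape f E p) 0 n \ avoid f E 0 n ⊆
      ⋃ i ∈ Finset.Ico (n - p) n, f^[i] ⁻¹' E := by
  intro x hx
  by_contra hcon
  simp only [mem_iUnion, Finset.mem_Ico, mem_preimage, not_exists, exists_prop, not_and] at hcon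
  have key : ∀ k i, i < n → n - i ≤ k → f^[i] x ∉ E := by
    intro k
    induction k with
    | zero => intro i hi hk; omega
    | succ k ih =>
      intro i hi hk hxi
      by_cases hip : n - p ≤ i
      · exact hcon i ⟨hip, hi⟩ hxi
      have := hx.1 i hi
      rw [zero_add] at this
      refine this ⟨hxi, fun j h1 h2 => ?_⟩
      rw [← Function.iterate_add_apply]
      exact ih (j + i) (by omega) (by omega)
  exact hx.2 fun i hi => by rw [zero_add]; exact key n i hi (by omega)

/-- Once the orbit has come back to `E`, it cannot stay away for `p` consecutive steps before time
`N`: the visit preceding such a pause would be a forbidden return to the escape set. -/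
theorem exists_mem_of_return {E : Set X} {p N i : ℕ}
    (hret : ∀ x ∈ escape f E p, ∀ j, 1 ≤ j → j ≤ N → f^[j] x ∉ escape f E p)
    {x : X} (hx : x ∈ escape f E p) (hi : 1 ≤ i) (hxi : f^[i] x ∈ E) {m : ℕ} (him : i ≤ m)
    (hmN : m ≤ N) : ∃ r, 1 ≤ r ∧ r ≤ p ∧ f^[m + r] x ∈ E := by
  have next : ∀ s, 1 ≤ s → s ≤ N → f^[s] x ∈ E → ∃ r, 1 ≤ r ∧ r ≤ p ∧ f^[s + r] x ∈ E := by
    intro s h1 h2 hs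
    by_contra! hcon
    refine hret x hx s h1 h2 ⟨hs, fun r hr1 hr2 => ?_⟩
    rw [← Function.iterate_add_apply, add_comm]
    exact hcon r hr1 hr2
  induction m, him using Nat.le_induction with
  | base => exact next i hi hmN hxi
  | succ m him ih =>
    obtain ⟨r, h1, h2, h3⟩ := ih (by omega)
    rcases h1.eq_or_lt with rfl | h1
    · exact next (m + 1) (by omega) hmN h3
    · exact ⟨r - 1, by omega, by omega, by rwa [show m + 1 + (r - 1) = m + r by omega]⟩

end Sets

/-! ### Measure of exceedances that recur after `p` quiet steps -/

section Measure

variable {X : Type*} [MeasurableSpace X] {f : X → X} {μ : Measure X}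

theorem measurableSet_escape (hf : Measurable f) {E : Set X} (hE : MeasurableSet E) (q : ℕ) :
    MeasurableSet (escape f E q) := by
  have : escape f E q = E ∩ ⋂ i ∈ Finset.Icc 1 q, f^[i] ⁻¹' Eᶜ := by
    ext x
    simp only [escape, mem_ofPred_eq, mem_inter_iff, mem_iInter, Finset.mem_Icc, mem_preimage,
      mem_compl_iff, and_imp]
  rw [this]
  exact hE.inter (Finset.measurableSet_biInter _ fun i _ => hf.iterate i hE.compl)

theorem measurableSet_avoid (hf : Measurable f) {B : Set X} (hB : MeasurableSet B) (s ℓ : ℕ) :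
    MeasurableSet (avoid f B s ℓ) := by
  have : avoid f B s ℓ = ⋂ i ∈ Finset.range ℓ, f^[s + i] ⁻¹' Bᶜ := by
    ext x
    simp only [avoid, mem_ofPred_eq, mem_iInter, Finset.mem_range, mem_preimage, mem_compl_iff]
  rw [this]
  exact Finset.measurableSet_biInter _ fun i _ => hf.iterate (s + i) hB.compl

theorem measureReal_preimage_iterate (hf : MeasurePreserving f μ μ) {A : Set X}
    (hA : MeasurableSet A) (i : ℕ) : μ.real (f^[i] ⁻¹' A) = μ.real A := by
  rw [measureReal_def, (hf.iterate i).measure_preimage hA.nullMeasurableSet, measureReal_def]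

variable [IsProbabilityMeasure μ]

/-- If points of `escape f E p` do not come back to that set up to time `N`, then few of them
visit `E` at a time `i > p`. -/
theorem mul_measureReal_escape_inter_le (hf : MeasurePreserving f μ μ) {E : Set X}
    (hE : MeasurableSet E) {p N i : ℕ}
    (hret : ∀ x ∈ escape f E p, ∀ j, 1 ≤ j → j ≤ N → f^[j] x ∉ escape f E p)
    (hi : 1 ≤ i) :
    ((N + 1 - i : ℕ) : ℝ) * μ.real (escape f E p ∩ f^[i] ⁻¹' E) ≤ p * μ.real E := by
  set S := escape f E p ∩ f^[i] ⁻¹' E with hS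
  have hSm : MeasurableSet S :=
    (measurableSet_escape hf.measurable hE p).inter (hf.measurable.iterate i hE)
  have h1 : ∀ m ∈ Finset.Icc i N,
      μ.real S ≤ ∑ r ∈ Finset.Icc 1 p, μ.real (S ∩ f^[m + r] ⁻¹' E) := by
    intro m hm
    rw [Finset.mem_Icc] at hm
    refine le_trans (measureReal_mono (fun x hx => ?_) (measure_ne_top _ _))
      (measureReal_biUnion_finset_le (Finset.Icc 1 p) fun r => S ∩ f^[m + r] ⁻¹' E)
    obtain ⟨r, hr1, hr2, hr⟩ := exists_mem_of_return hret hx.1 hi hx.2 hm.1 hm.2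
    exact mem_biUnion (Finset.mem_coe.2 (Finset.mem_Icc.2 ⟨hr1, hr2⟩)) ⟨hx, hr⟩
  -- Pulling the `m`-th set back by `N - m` moves every visit to `E` to the common time `N + r`. The
  -- pulled-back sets are disjoint, since a common point would return to the escape set within `N`
  -- steps.
  have h2 : ∀ r, ∑ m ∈ Finset.Icc i N, μ.real (S ∩ f^[m + r] ⁻¹' E) ≤ μ.real E := by
    intro r
    have hmeas : ∀ m, MeasurableSet (S ∩ f^[m + r] ⁻¹' E) := fun m =>
      hSm.inter (hf.measurable.iterate _ hE)
    have hdisj : (↑(Finset.Icc i N) : Set ℕ).PairwiseDisjoint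
        fun m => f^[N - m] ⁻¹' (S ∩ f^[m + r] ⁻¹' E) := by
      have aux : ∀ a b, i ≤ a → a < b → b ≤ N →
          Disjoint (f^[N - a] ⁻¹' (S ∩ f^[a + r] ⁻¹' E)) (f^[N - b] ⁻¹' (S ∩ f^[b + r] ⁻¹' E)) := by
        intro a b _ hab hbN
        refine disjoint_left.2 fun y hya hyb => ?_
        have h3 := hret _ hyb.1.1 (b - a) (by omega) (by omega)
        rw [← Function.iterate_add_apply, show b - a + (N - b) = N - a by omega] at h3
        exact h3 hya.1.1
      intro a ha b hb hab
      simp only [Finset.coe_Icc, mem_Icc] at ha hb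
      rcases lt_or_gt_of_ne hab with h | h
      · exact aux a b ha.1 h hb.2
      · exact (aux b a hb.1 h ha.2).symm
    calc ∑ m ∈ Finset.Icc i N, μ.real (S ∩ f^[m + r] ⁻¹' E)
        = ∑ m ∈ Finset.Icc i N, μ.real (f^[N - m] ⁻¹' (S ∩ f^[m + r] ⁻¹' E)) :=
          Finset.sum_congr rfl fun m _ => (measureReal_preimage_iterate hf (hmeas m) _).symm
      _ = μ.real (⋃ m ∈ Finset.Icc i N, f^[N - m] ⁻¹' (S ∩ f^[m + r] ⁻¹' E)) :=
          (measureReal_biUnion_finset hdisj fun m _ => hf.measurable.iterate _ (hmeas m)).symm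
      _ ≤ μ.real (f^[N + r] ⁻¹' E) := by
          refine measureReal_mono (iUnion₂_subset fun m hm y hy => ?_) (measure_ne_top _ _)
          have h3 := hy.2
          rw [Finset.mem_Icc] at hm
          rwa [mem_preimage, ← Function.iterate_add_apply,
            show m + r + (N - m) = N + r by omega] at h3
      _ = μ.real E := measureReal_preimage_iterate hf hE _
  calc ((N + 1 - i : ℕ) : ℝ) * μ.real S = ∑ m ∈ Finset.Icc i N, μ.real S := by simp
    _ ≤ ∑ m ∈ Finset.Icc i N, ∑ r ∈ Finset.Icc 1 p, μ.real (S ∩ f^[m + r] ⁻¹' E) :=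
        Finset.sum_le_sum h1
    _ = ∑ r ∈ Finset.Icc 1 p, ∑ m ∈ Finset.Icc i N, μ.real (S ∩ f^[m + r] ⁻¹' E) :=
        Finset.sum_comm
    _ ≤ ∑ r ∈ Finset.Icc 1 p, μ.real E := Finset.sum_le_sum fun r _ => h2 r
    _ = p * μ.real E := by simp

theorem measureReal_escape_diff_le (E : Set X) (p q : ℕ) :
    μ.real (escape f E p \ escape f E q) ≤
      ∑ i ∈ Finset.Icc (p + 1) q, μ.real (escape f E p ∩ f^[i] ⁻¹' E) := by
  refine le_trans (measureReal_mono (fun x hx => ?_) (measure_ne_top _ _))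
    (measureReal_biUnion_finset_le _ _)
  by_contra hcon
  simp only [mem_iUnion, Finset.mem_Icc, mem_inter_iff, mem_preimage, not_exists, exists_prop,
    not_and] at hcon
  refine hx.2 ⟨hx.1.1, fun i h1 h2 => ?_⟩
  by_cases hip : i ≤ p
  · exact hx.1.2 i h1 hip
  · exact hcon i ⟨by omega, h2⟩ hx.1

theorem tendsto_mul_escape_diff (hf : MeasurePreserving f μ μ) {E : ℕ → Set X}
    (hE : ∀ n, MeasurableSet (E n)) {p : ℕ} {c : ℝ}
    (hc : Tendsto (fun n : ℕ => (n : ℝ) * μ.real (E n)) atTop (𝓝 c))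
    (hret : ∀ N, ∀ᶠ n in atTop, ∀ x ∈ escape f (E n) p, ∀ j, 1 ≤ j → j ≤ N →
      f^[j] x ∉ escape f (E n) p) (q : ℕ) :
    Tendsto (fun n : ℕ => (n : ℝ) * μ.real (escape f (E n) p \ escape f (E n) q))
      atTop (𝓝 0) := by
  -- A return horizon growing with `n` gives, for each fixed `i`, a bound of order `p * (n μ(E n)) /
  -- N n`, which vanishes.
  obtain ⟨N, hN, hNev⟩ := exists_tendsto_atTop_eventually hret
  have hone : ∀ i ∈ Finset.Icc (p + 1) q, Tendsto
      (fun n : ℕ => (n : ℝ) * μ.real (escape f (E n) p ∩ f^[i] ⁻¹' E n)) atTop (𝓝 0) := by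
    intro i hi
    rw [Finset.mem_Icc] at hi
    have hinv : Tendsto (fun n => ((N n + 1 - i : ℕ) : ℝ)⁻¹ * (p * ((n : ℝ) * μ.real (E n))))
        atTop (𝓝 (0 * (p * c))) := by
      refine Tendsto.mul ?_ (hc.const_mul _)
      refine tendsto_inv_atTop_zero.comp (tendsto_natCast_atTop_atTop.comp ?_)
      exact (tendsto_sub_atTop_nat i).comp ((tendsto_add_atTop_nat 1).comp hN)
    rw [zero_mul] at hinv
    refine squeeze_zero' (Eventually.of_forall fun n => by positivity) ?_ hinv
    filter_upwards [hNev, hN.eventually_ge_atTop i] with n hn hni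
    have h1 := mul_measureReal_escape_inter_le hf (hE n) hn (i := i) (by omega)
    have h2 : (0 : ℝ) < ((N n + 1 - i : ℕ) : ℝ) := by
      have : 0 < N n + 1 - i := by omega
      exact_mod_cast this
    rw [inv_mul_eq_div, le_div_iff₀ h2]
    calc (n : ℝ) * μ.real (escape f (E n) p ∩ f^[i] ⁻¹' E n) * ((N n + 1 - i : ℕ) : ℝ)
        = n * (((N n + 1 - i : ℕ) : ℝ) * μ.real (escape f (E n) p ∩ f^[i] ⁻¹' E n)) := by ring
      _ ≤ n * (p * μ.real (E n)) := by gcongr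
      _ = p * (n * μ.real (E n)) := by ring
  have hsum := tendsto_finsetSum (Finset.Icc (p + 1) q) hone
  rw [Finset.sum_const_zero] at hsum
  refine squeeze_zero (fun n => by positivity) (fun n => ?_) hsum
  rw [← Finset.mul_sum]
  gcongr
  exact measureReal_escape_diff_le _ _ _

end Measure

/-- Correlations of the indicator of `B` against indicators of measurable sets decay with
rate `ρ`. -/
def IndicatorDecay {X : Type*} [MeasurableSpace X] (μ : Measure X) (f : X → X) (ρ : ℕ → ℝ)
    (B : Set X) : Prop :=
  ∀ s, 1 ≤ s → ∀ G, MeasurableSet G →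
    |μ.real (B ∩ f^[s] ⁻¹' G) - μ.real B * μ.real G| ≤ ρ s * μ.real G

/-! ### Avoidance estimates for a single set with decaying correlations -/

section Single

variable {X : Type*} [MeasurableSpace X] {f : X → X} {μ : Measure X} {ρ : ℕ → ℝ} {B : Set X}

/-- A better rate at an earlier time `j ≤ s` can be used at time `s`: apply it to the preimage of
`G` under `f^[s - j]`, which has the same measure. This supplies the monotonicity in the gap that
the mixing condition demands. -/
theorem IndicatorDecay.toRunningMin (hf : MeasurePreserving f μ μ) (h : IndicatorDecay μ f ρ B) :
    IndicatorDecay μ f (runningMin ρ) B := by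
  intro s hs G hG
  obtain ⟨j, hj1, hjs, hj⟩ := exists_runningMin_eq ρ hs
  have h1 := h j hj1 (f^[s - j] ⁻¹' G) (hf.measurable.iterate _ hG)
  rw [measureReal_preimage_iterate hf hG, ← preimage_comp, ← Function.iterate_add,
    Nat.sub_add_cancel hjs] at h1
  rwa [hj]

theorem IndicatorDecay.measureReal_inter_le (h : IndicatorDecay μ f ρ B) {s : ℕ} (hs : 1 ≤ s)
    {G : Set X} (hG : MeasurableSet G) :
    μ.real (B ∩ f^[s] ⁻¹' G) ≤ μ.real B * μ.real G + ρ s * μ.real G := by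
  linarith [(abs_le.1 (h s hs G hG)).2]

theorem sum_Ico_le_tail (hρ : ∀ n, 1 ≤ n → 0 ≤ ρ n) (hs : Summable ρ) (N b : ℕ) :
    ∑ j ∈ Finset.Ico (N + 1) b, ρ j ≤ ∑' j, ρ (j + (N + 1)) := by
  rw [Finset.sum_Ico_eq_sum_range]
  simp only [add_comm (N + 1)]
  exact ((summable_nat_add_iff (N + 1)).2 hs).sum_le_tsum _ fun j _ => hρ _ (by omega)

/-- Terms with `j ≤ N` vanish because there is no return, so the rate is only summed from `N + 1`
on. -/
theorem IndicatorDecay.sum_inter_le (h : IndicatorDecay μ f ρ B) (hB : MeasurableSet B)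
    (hρ : ∀ n, 1 ≤ n → 0 ≤ ρ n) (hs : Summable ρ) {N a b : ℕ} (ha : 1 ≤ a)
    (hret : ∀ x ∈ B, ∀ j, 1 ≤ j → j ≤ N → f^[j] x ∉ B) :
    ∑ j ∈ Finset.Ico a b, μ.real (B ∩ f^[j] ⁻¹' B) ≤
      ((b - a : ℕ) : ℝ) * μ.real B ^ 2 + μ.real B * ∑' j, ρ (j + (N + 1)) := by
  have hterm : ∀ j ∈ Finset.Ico a b, μ.real (B ∩ f^[j] ⁻¹' B) ≤
      μ.real B ^ 2 + μ.real B * (if N + 1 ≤ j then ρ j else 0) := by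
    intro j hj
    rw [Finset.mem_Ico] at hj
    split_ifs with hN
    · have := h.measureReal_inter_le (s := j) (by omega) hB
      linarith
    · have : B ∩ f^[j] ⁻¹' B = ∅ :=
        eq_empty_of_forall_notMem fun x hx => hret x hx.1 j (by omega) (by omega) hx.2
      rw [this, measureReal_empty]
      positivity
  refine (Finset.sum_le_sum hterm).trans ?_
  rw [Finset.sum_add_distrib, Finset.sum_const, Nat.card_Ico, nsmul_eq_mul, ← Finset.mul_sum,
    ← Finset.sum_filter]
  gcongr
  refine (Finset.sum_le_sum_of_subset_of_nonneg (t := Finset.Ico (N + 1) b) ?_ ?_).trans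
    (sum_Ico_le_tail hρ hs N b)
  · intro j hj
    simp only [Finset.mem_filter, Finset.mem_Ico] at hj ⊢
    omega
  · intro j hj _
    rw [Finset.mem_Ico] at hj
    exact hρ j (by omega)

variable [IsProbabilityMeasure μ]

/-- Mixing applies after a gap `t`. Moving the avoidance window from start `1` to start `t` drops
the times `1, …, t - 1` and adds `ℓ + 1, …, ℓ + t - 1`; returns to `B` at either group are
controlled by `sum_inter_le`. -/
theorem IndicatorDecay.abs_sub_avoid_le (hf : MeasurePreserving f μ μ)
    (h : IndicatorDecay μ f ρ B) (hB : MeasurableSet B)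
    (hρ : ∀ n, 1 ≤ n → 0 ≤ ρ n) (hs : Summable ρ) {N t : ℕ} (ht : 1 ≤ t)
    (hret : ∀ x ∈ B, ∀ j, 1 ≤ j → j ≤ N → f^[j] x ∉ B) (ℓ : ℕ) :
    |μ.real (B ∩ avoid f B 1 ℓ) - μ.real B * μ.real (avoid f B 0 ℓ)| ≤
      t * μ.real B ^ 2 + μ.real B * ∑' j, ρ (j + (N + 1)) + runningMin ρ t := by
  have hmix := h.toRunningMin hf t ht _ (measurableSet_avoid hf.measurable hB 0 ℓ)
  rw [← avoid_eq_preimage] at hmix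
  have hmix' : |μ.real (B ∩ avoid f B t ℓ) - μ.real B * μ.real (avoid f B 0 ℓ)| ≤
      runningMin ρ t :=
    hmix.trans (mul_le_of_le_one_right (runningMin_nonneg hρ t) measureReal_le_one)
  have cover : ∀ (V W : Set X) (a b : ℕ), 1 ≤ a → b - a ≤ t →
      (∀ x ∈ V, x ∉ W → ∃ j, a ≤ j ∧ j < b ∧ f^[j] x ∈ B) →
      μ.real (B ∩ V) ≤ μ.real (B ∩ W) +
        (t * μ.real B ^ 2 + μ.real B * ∑' j, ρ (j + (N + 1))) := by
    intro V W a b ha hab hVW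
    have hsub : B ∩ V ⊆ (B ∩ W) ∪ ⋃ j ∈ Finset.Ico a b, B ∩ f^[j] ⁻¹' B := by
      rintro x ⟨hxB, hxV⟩
      by_cases hxW : x ∈ W
      · exact Or.inl ⟨hxB, hxW⟩
      · obtain ⟨j, h1, h2, h3⟩ := hVW x hxV hxW
        exact Or.inr (mem_biUnion (Finset.mem_coe.2 (Finset.mem_Ico.2 ⟨h1, h2⟩)) ⟨hxB, h3⟩)
    have h1 : μ.real (B ∩ V) ≤ μ.real (B ∩ W) +
        ∑ j ∈ Finset.Ico a b, μ.real (B ∩ f^[j] ⁻¹' B) :=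
      (measureReal_mono hsub (measure_ne_top _ _)).trans ((measureReal_union_le _ _).trans
        (add_le_add_right (measureReal_biUnion_finset_le _ _) _))
    have h2 := h.sum_inter_le hB hρ hs ha hret (b := b)
    have h3 : ((b - a : ℕ) : ℝ) * μ.real B ^ 2 ≤ t * μ.real B ^ 2 := by gcongr
    linarith
  have h1 := cover (avoid f B t ℓ) (avoid f B 1 ℓ) 1 t le_rfl (by omega) (by
    intro x hx hx'
    simp only [avoid, mem_ofPred_eq, not_forall, not_not] at hx hx'
    obtain ⟨i, hi, hxi⟩ := hx'
    refine ⟨1 + i, by omega, ?_, hxi⟩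
    by_contra hlt
    have := hx (1 + i - t) (by omega)
    rw [show t + (1 + i - t) = 1 + i by omega] at this
    exact this hxi)
  have h2 := cover (avoid f B 1 ℓ) (avoid f B t ℓ) (ℓ + 1) (ℓ + t) (by omega) (by omega) (by
    intro x hx hx'
    simp only [avoid, mem_ofPred_eq, not_forall, not_not] at hx hx'
    obtain ⟨i, hi, hxi⟩ := hx'
    refine ⟨t + i, ?_, by omega, hxi⟩
    by_contra hlt
    have := hx (t + i - 1) (by omega)
    rw [show 1 + (t + i - 1) = t + i by omega] at this
    exact this hxi)
  rw [abs_le] at hmix' ⊢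
  constructor <;> linarith [hmix'.1, hmix'.2]

/-- Splitting off time `0` gives a recursion with factor `1 - μ(B)` and error `e`; the factor lies
in `[0, 1]`, so the errors at most add up. -/
theorem abs_avoid_sub_pow_le (hf : MeasurePreserving f μ μ) (hB : MeasurableSet B) {e : ℝ}
    (he : ∀ ℓ, |μ.real (B ∩ avoid f B 1 ℓ) - μ.real B * μ.real (avoid f B 0 ℓ)| ≤ e) (ℓ : ℕ) :
    |μ.real (avoid f B 0 ℓ) - (1 - μ.real B) ^ ℓ| ≤ ℓ * e := by
  induction ℓ with
  | zero =>
    have : avoid f B 0 0 = univ := eq_univ_of_forall fun x i hi => absurd hi (by omega)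
    simp [this]
  | succ ℓ ih =>
    have hm := measurableSet_avoid hf.measurable hB
    have hstep : μ.real (avoid f B 0 (ℓ + 1)) =
        μ.real (avoid f B 0 ℓ) - μ.real (B ∩ avoid f B 1 ℓ) := by
      rw [avoid_zero_succ, measureReal_sdiff (by rw [← avoid_eq_preimage]; exact inter_subset_right)
        (hB.inter (hm 1 ℓ)), measureReal_preimage_iterate hf (hm 0 ℓ)]
    have hb0 : 0 ≤ 1 - μ.real B := sub_nonneg.2 measureReal_le_one
    have hb1 : 1 - μ.real B ≤ 1 := by linarith [measureReal_nonneg (μ := μ) (s := B)]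
    have heq : μ.real (avoid f B 0 (ℓ + 1)) - (1 - μ.real B) ^ (ℓ + 1) =
        (1 - μ.real B) * (μ.real (avoid f B 0 ℓ) - (1 - μ.real B) ^ ℓ) -
          (μ.real (B ∩ avoid f B 1 ℓ) - μ.real B * μ.real (avoid f B 0 ℓ)) := by
      rw [hstep]; ring
    rw [heq]
    refine (abs_sub _ _).trans ?_
    rw [abs_mul, abs_of_nonneg hb0]
    have h1 := mul_le_of_le_one_left (abs_nonneg (μ.real (avoid f B 0 ℓ) - (1 - μ.real B) ^ ℓ)) hb1
    push_cast
    linarith [he ℓ]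

end Single

/-! ### Exponential limit law -/

section Limits

variable {X : Type*} [MeasurableSpace X] {f : X → X} {μ : Measure X} [IsProbabilityMeasure μ]
  {ρ : ℕ → ℝ}

/-- Poisson-type limit for sets with long return times and summable decay of correlations. -/
theorem tendsto_avoid_exp (hf : MeasurePreserving f μ μ) {B : ℕ → Set X}
    (hB : ∀ n, MeasurableSet (B n)) (hρ : ∀ n, 1 ≤ n → 0 ≤ ρ n) (hs : Summable ρ)
    (hdec : ∀ n, 1 ≤ n → IndicatorDecay μ f ρ (B n)) {c : ℝ}
    (hc : Tendsto (fun n : ℕ => (n : ℝ) * μ.real (B n)) atTop (𝓝 c))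
    (hret : ∀ N, ∀ᶠ n in atTop, ∀ x ∈ B n, ∀ j, 1 ≤ j → j ≤ N → f^[j] x ∉ B n) :
    Tendsto (fun n => μ.real (avoid f (B n) 0 n)) atTop (𝓝 (Real.exp (-c))) := by
  obtain ⟨t, -, ht1, -, -, ht, hrt⟩ := exists_gaps (runningMin_nonneg hρ)
    (tendsto_nat_mul_runningMin hρ hs)
  obtain ⟨N, hN, hNev⟩ := exists_tendsto_atTop_eventually hret
  have hpow : Tendsto (fun n : ℕ => (1 - μ.real (B n)) ^ n) atTop (𝓝 (Real.exp (-c))) := by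
    have := Real.tendsto_one_add_pow_exp_of_tendsto (g := fun n => -μ.real (B n)) (t := -c)
      (by simpa using hc.neg)
    simpa [sub_eq_add_neg] using this
  have htail : Tendsto (fun n => ∑' j, ρ (j + (N n + 1))) atTop (𝓝 0) :=
    (tendsto_sum_nat_add ρ).comp ((tendsto_add_atTop_nat 1).comp hN)
  have herr : Tendsto (fun n : ℕ => (n : ℝ) * (t n * μ.real (B n) ^ 2 +
      μ.real (B n) * ∑' j, ρ (j + (N n + 1)) + runningMin ρ (t n))) atTop (𝓝 0) := by
    have h1 := ((ht.mul (hc.pow 2)).add (hc.mul htail)).add hrt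
    simp only [zero_mul, mul_zero, add_zero] at h1
    refine h1.congr' ?_
    filter_upwards [eventually_gt_atTop 0] with n hn
    have hn' : (n : ℝ) ≠ 0 := by exact_mod_cast hn.ne'
    field_simp
  have hdiff : Tendsto (fun n => μ.real (avoid f (B n) 0 n) - (1 - μ.real (B n)) ^ n)
      atTop (𝓝 0) := by
    refine squeeze_zero_norm' ?_ herr
    filter_upwards [hNev, eventually_ge_atTop 1] with n hn hn1
    rw [Real.norm_eq_abs]
    exact abs_avoid_sub_pow_le hf (hB n)
      (fun ℓ => (hdec n hn1).abs_sub_avoid_le hf (hB n) hρ hs (ht1 n) hn ℓ) n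
  simpa using hdiff.add hpow

end Limits

/-! ### From decay in `C` to decay for indicators -/

section Decay

variable {X : Type*} [MeasurableSpace X] {f : X → X} {μ : Measure X} [IsProbabilityMeasure μ]
  {C : Type*} [NormedAddCommGroup C] [NormedSpace ℝ C] {ι : C →ₗ[ℝ] Lp ℝ 1 μ}

theorem SummableDecay.exists_indicatorDecay (hf : MeasurePreserving f μ μ)
    (hdecay : SummableDecay μ f ι) {A : ℕ → Set X} (hA : ∀ n, MeasurableSet (A n))
    (hbdd : BoundedIndicators μ ι A) :
    ∃ ρ : ℕ → ℝ, (∀ n, 1 ≤ n → 0 ≤ ρ n) ∧ Summable ρ ∧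
      ∀ n, 1 ≤ n → IndicatorDecay μ f ρ (A n) := by
  obtain ⟨ρ, hρ, hs, hdec⟩ := hdecay
  obtain ⟨K, hK⟩ := hbdd
  have hK0 : 0 ≤ K := by
    obtain ⟨φ, -, h⟩ := hK 1 le_rfl
    exact (norm_nonneg φ).trans h
  refine ⟨fun n => ρ n * K, fun n hn => mul_nonneg (hρ n hn).le hK0, hs.mul_right K, ?_⟩
  intro n hn s hs1 G hG
  obtain ⟨φ, hφ, hφK⟩ := hK n hn
  -- The `L¹` norm of the test function is `μ(G)`; this factor, kept in the bound, is what makes the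
  -- sums over return times small.
  have h := (hdec φ (G.indicator fun _ => 1) ((integrable_const 1).indicator hG) s hs1).2
  have e1 : ∫ x, ι φ x * G.indicator (fun _ => (1 : ℝ)) (f^[s] x) ∂μ =
      μ.real (A n ∩ f^[s] ⁻¹' G) := by
    rw [← integral_indicator_one ((hA n).inter (hf.measurable.iterate s hG))]
    refine integral_congr_ae (hφ.mono fun x hx => ?_)
    simp only [hx, inter_indicator_one, Pi.mul_apply]
    rfl
  have e2 : ∫ x, ι φ x ∂μ = μ.real (A n) := by
    rw [← integral_indicator_one (hA n)]
    exact integral_congr_ae hφ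
  have e3 : ∫ x, G.indicator (fun _ => (1 : ℝ)) x ∂μ = μ.real G := integral_indicator_one hG
  have e4 : ∫ x, |G.indicator (fun _ => (1 : ℝ)) x| ∂μ = μ.real G := by
    rw [← e3]
    exact integral_congr_ae (Eventually.of_forall fun x =>
      abs_of_nonneg (indicator_nonneg (fun _ _ => zero_le_one) x))
  rw [e1, e2, e3, e4] at h
  refine h.trans ?_
  exact mul_le_mul_of_nonneg_right (mul_le_mul_of_nonneg_left hφK (hρ s hs1).le)
    measureReal_nonneg

end Decay

/-! ### The mixing condition, cluster separation and the law of the maxima -/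

section Exceedances

variable {X : Type*} {f : X → X} {d : ℕ} {ψ : Fin d → X → EReal} {u : ℕ → Fin d → ℝ}

theorem exceedance_zero (n : ℕ) :
    exceedance f ψ u 0 n = {x | ∃ j, (u n j : EReal) < ψ j x} := by
  ext x
  simp only [exceedance, mem_ofPred_eq, and_iff_left_iff_imp]
  intro _ i h1 h2
  omega

theorem exceedance_eq_escape (q n : ℕ) :
    exceedance f ψ u q n = escape f (exceedance f ψ u 0 n) q := by
  ext x
  simp only [exceedance_zero]
  simp only [exceedance, escape, mem_ofPred_eq, not_exists, not_lt]

theorem maxLE_eq_avoid (n : ℕ) : maxLE f ψ u n = avoid f (exceedance f ψ u 0 n) 0 n := by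
  ext x
  simp only [exceedance_zero]
  simp only [maxLE, partialMax, avoid, mem_ofPred_eq, Finset.sup_le_iff, Finset.mem_range,
    not_exists, not_lt, zero_add]
  exact ⟨fun h i hi j => h j i hi, fun h j i hi => h i hi j⟩

theorem notMem_of_lt_firstReturn {A : Set X} {N : ℕ} (h : (N : ℕ∞) < firstReturn f A) :
    ∀ x ∈ A, ∀ j, 1 ≤ j → j ≤ N → f^[j] x ∉ A := by
  intro x hx j h1 h2 hj
  refine absurd h (not_lt.2 ((iInf₂_le x hx).trans ?_))
  exact (iInf₂_le j ⟨h1, hj⟩).trans (by exact_mod_cast h2)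

theorem eventually_notMem_of_tendsto_firstReturn {A : ℕ → Set X}
    (h : Tendsto (fun n => firstReturn f (A n)) atTop (𝓝 ⊤)) (N : ℕ) :
    ∀ᶠ n in atTop, ∀ x ∈ A n, ∀ j, 1 ≤ j → j ≤ N → f^[j] x ∉ A n :=
  (h.eventually (lt_mem_nhds (ENat.natCast_lt_top N))).mono fun _ hn => notMem_of_lt_firstReturn hn

variable [MeasurableSpace X] {μ : Measure X} [IsProbabilityMeasure μ] {ρ : ℕ → ℝ} {c : ℝ} {p : ℕ}

theorem mixingCondition_of_indicatorDecay (hf : MeasurePreserving f μ μ)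
    (hE : ∀ n, MeasurableSet (exceedance f ψ u 0 n))
    (hρ : ∀ n, 1 ≤ n → 0 ≤ ρ n)
    (hdec : ∀ n, 1 ≤ n → IndicatorDecay μ f ρ (exceedance f ψ u p n))
    (hc : Tendsto (fun n : ℕ => (n : ℝ) * μ.real (exceedance f ψ u 0 n)) atTop (𝓝 c))
    (hret : Tendsto (fun n => firstReturn f (exceedance f ψ u p n)) atTop (𝓝 ⊤))
    {t : ℕ → ℕ} (ht1 : ∀ n, 1 ≤ t n) (ht : Tendsto (fun n : ℕ => (t n : ℝ) / n) atTop (𝓝 0))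
    (hrt : Tendsto (fun n : ℕ => (n : ℝ) * runningMin ρ (t n)) atTop (𝓝 0)) :
    MixingCondition μ f ψ u fun _ => t := by
  have hm : ∀ q n, MeasurableSet (exceedance f ψ u q n) := fun q n => by
    rw [exceedance_eq_escape]
    exact measurableSet_escape hf.measurable (hE n) q
  -- Decay is known for the index `p` only. Passing from `p` to `q ≥ p` costs the measure of the
  -- difference once in the intersection and once in the product, hence the `2`. For `q < p` the
  -- trivial bound `1` suffices, as only large `q` matter in the limit.
  set δ : ℕ → ℕ → ℝ := fun q n =>
    if p ≤ q then 2 * μ.real (exceedance f ψ u p n \ exceedance f ψ u q n) else 1 with hδ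
  refine ⟨fun q n s => δ q n + runningMin ρ s, ?_,
    fun q n => (runningMin_antitone ρ).const_add _, fun _ => ht1, fun _ => ht, ?_⟩
  · intro q n s ℓ hn hs hℓ
    rw [noOccurrence_eq_avoid _ _ hℓ, noOccurrence_eq_avoid _ _ hℓ]
    set Q := exceedance f ψ u q n with hQ
    set P := exceedance f ψ u p n with hP
    have hW := measurableSet_avoid hf.measurable (hm q n) 0 ℓ
    by_cases hpq : p ≤ q
    · simp only [hδ, if_pos hpq]
      have hQP : Q ⊆ P := by
        rw [hQ, hP, exceedance_eq_escape, exceedance_eq_escape p]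
        exact escape_anti _ hpq
      have hPW := (hdec n hn).toRunningMin hf s hs _ hW
      rw [← avoid_eq_preimage] at hPW
      replace hPW := hPW.trans (mul_le_of_le_one_right (runningMin_nonneg hρ s) measureReal_le_one)
      have hPQ : μ.real P = μ.real Q + μ.real (P \ Q) := by
        rw [measureReal_sdiff hQP (hm q n)]; ring
      have h1 : μ.real (Q ∩ avoid f Q s ℓ) ≤ μ.real (P ∩ avoid f Q s ℓ) :=
        measureReal_mono (inter_subset_inter_left _ hQP) (measure_ne_top _ _)
      have h2 : μ.real (P ∩ avoid f Q s ℓ) ≤ μ.real (Q ∩ avoid f Q s ℓ) + μ.real (P \ Q) := by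
        refine (measureReal_mono ?_ (measure_ne_top _ _)).trans (measureReal_union_le _ _)
        rintro x ⟨hx, hx'⟩
        by_cases hxQ : x ∈ Q
        · exact Or.inl ⟨hxQ, hx'⟩
        · exact Or.inr ⟨hx, hxQ⟩
      have h3 : 0 ≤ μ.real (avoid f Q 0 ℓ) := measureReal_nonneg
      have h4 : μ.real (P \ Q) * μ.real (avoid f Q 0 ℓ) ≤ μ.real (P \ Q) :=
        mul_le_of_le_one_right measureReal_nonneg measureReal_le_one
      have h5 : 0 ≤ μ.real (P \ Q) := measureReal_nonneg
      have h6 : 0 ≤ μ.real (P \ Q) * μ.real (avoid f Q 0 ℓ) := mul_nonneg h5 h3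
      rw [hPQ, add_mul] at hPW
      rw [abs_le] at hPW ⊢
      constructor <;> linarith [hPW.1, hPW.2]
    · simp only [hδ, if_neg hpq]
      refine le_add_of_le_of_nonneg ?_ (runningMin_nonneg hρ s)
      exact abs_sub_le_of_nonneg_of_le measureReal_nonneg measureReal_le_one
        (mul_nonneg measureReal_nonneg measureReal_nonneg)
        (mul_le_one₀ measureReal_le_one measureReal_nonneg measureReal_le_one)
  · refine tendsto_const_nhds.congr' ?_
    filter_upwards [eventually_ge_atTop p] with q hpq
    have hdiff : Tendsto (fun n : ℕ => (n : ℝ) *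
        μ.real (exceedance f ψ u p n \ exceedance f ψ u q n)) atTop (𝓝 0) := by
      have h := tendsto_mul_escape_diff hf hE hc (p := p) (fun N => by
        simpa only [← exceedance_eq_escape] using
          eventually_notMem_of_tendsto_firstReturn hret N) q
      simpa only [← exceedance_eq_escape] using h
    have hlim : Tendsto (fun n : ℕ => (n : ℝ) * (δ q n + runningMin ρ (t n))) atTop (𝓝 0) := by
      have h := (hdiff.const_mul 2).add hrt
      simp only [mul_zero, add_zero] at h
      refine h.congr fun n => ?_
      simp only [hδ, if_pos hpq]
      ring
    exact (Tendsto.limsup_eq (continuous_coe_real_ereal.continuousAt.tendsto.comp hlim)).symm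

/-- For `q ≥ p`, decay is applied to the larger set of index `p` in the first factor. The products
of measures sum to `O(1 / k n)` after multiplication by `n`; the correlations leave the tail of `ρ`
beyond `q`, which vanishes only as `q` grows. -/
theorem clusterSeparation_of_indicatorDecay (hf : MeasurePreserving f μ μ)
    (hE : ∀ n, MeasurableSet (exceedance f ψ u 0 n))
    (hρ : ∀ n, 1 ≤ n → 0 ≤ ρ n) (hs : Summable ρ)
    (hdec : ∀ n, 1 ≤ n → IndicatorDecay μ f ρ (exceedance f ψ u p n))
    (hc : Tendsto (fun n : ℕ => (n : ℝ) * μ.real (exceedance f ψ u 0 n)) atTop (𝓝 c))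
    {t k : ℕ → ℕ} (hk : Tendsto k atTop atTop)
    (hkt : Tendsto (fun n : ℕ => ((k n : ℝ) * t n) / n) atTop (𝓝 0)) :
    ClusterSeparation μ f ψ u fun _ => t := by
  have hm : ∀ q n, MeasurableSet (exceedance f ψ u q n) := fun q n => by
    rw [exceedance_eq_escape]
    exact measurableSet_escape hf.measurable (hE n) q
  refine ⟨k, hk, fun _ => hkt, ?_⟩
  set S : ℕ → ℕ → ℝ := fun q n => (n : ℝ) * ∑ j ∈ Finset.Ico (q + 1) (n / k n),
    μ.real (exceedance f ψ u q n ∩ f^[j] ⁻¹' exceedance f ψ u q n) with hS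
  set M : ℕ → ℕ → ℝ := fun q n => ((n : ℝ) * μ.real (exceedance f ψ u 0 n)) ^ 2 * (k n : ℝ)⁻¹ +
    (n : ℝ) * μ.real (exceedance f ψ u 0 n) * ∑' j, ρ (j + (q + 1)) with hM
  have htail0 : ∀ q, 0 ≤ ∑' j, ρ (j + (q + 1)) := fun q => tsum_nonneg fun j => hρ _ (by omega)
  have hSM : ∀ q, p ≤ q → ∀ n, 1 ≤ n → S q n ≤ M q n := by
    intro q hpq n hn
    set e := μ.real (exceedance f ψ u 0 n) with he
    have hsub : ∀ {a b}, a ≤ b → exceedance f ψ u b n ⊆ exceedance f ψ u a n := by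
      intro a b hab
      rw [exceedance_eq_escape, exceedance_eq_escape a]
      exact escape_anti _ hab
    have hterm : ∀ j ∈ Finset.Ico (q + 1) (n / k n),
        μ.real (exceedance f ψ u q n ∩ f^[j] ⁻¹' exceedance f ψ u q n) ≤ e ^ 2 + ρ j * e := by
      intro j hj
      rw [Finset.mem_Ico] at hj
      have hj0 := hρ j (by omega)
      have h1 := (hdec n hn).measureReal_inter_le (s := j) (by omega) (hm q n)
      have h2 : μ.real (exceedance f ψ u q n ∩ f^[j] ⁻¹' exceedance f ψ u q n) ≤
          μ.real (exceedance f ψ u p n ∩ f^[j] ⁻¹' exceedance f ψ u q n) :=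
        measureReal_mono (inter_subset_inter_left _ (hsub hpq)) (measure_ne_top _ _)
      have h3 : μ.real (exceedance f ψ u q n) ≤ e :=
        measureReal_mono (hsub (Nat.zero_le q)) (measure_ne_top _ _)
      have h4 : μ.real (exceedance f ψ u p n) ≤ e :=
        measureReal_mono (hsub (Nat.zero_le p)) (measure_ne_top _ _)
      refine (h2.trans h1).trans ?_
      rw [sq]
      gcongr
    have h1 := Finset.sum_le_sum hterm
    rw [Finset.sum_add_distrib, Finset.sum_const, Nat.card_Ico, nsmul_eq_mul,
      ← Finset.sum_mul] at h1
    have h2 : ((n / k n - (q + 1) : ℕ) : ℝ) ≤ n * (k n : ℝ)⁻¹ :=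
      le_trans (by exact_mod_cast Nat.sub_le _ _) Nat.cast_div_le
    have h3 := sum_Ico_le_tail hρ hs q (n / k n)
    have he0 : 0 ≤ e := measureReal_nonneg
    calc S q n ≤ n * ((n * (k n : ℝ)⁻¹) * e ^ 2 + (∑' j, ρ (j + (q + 1))) * e) := by
          refine mul_le_mul_of_nonneg_left (h1.trans ?_) n.cast_nonneg
          gcongr
      _ = M q n := by simp only [hM]; ring
  have hMlim : ∀ q, Tendsto (M q) atTop (𝓝 (c * ∑' j, ρ (j + (q + 1)))) := by
    intro q
    have h := ((hc.pow 2).mul (tendsto_inv_atTop_zero.comp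
      (tendsto_natCast_atTop_atTop.comp hk))).add (hc.mul_const (∑' j, ρ (j + (q + 1))))
    simpa using h
  have hlim : Tendsto (fun q : ℕ => ENNReal.ofReal (c * ∑' j, ρ (j + (q + 1)))) atTop (𝓝 0) := by
    have h := ((tendsto_sum_nat_add ρ).comp (tendsto_add_atTop_nat 1)).const_mul c
    rw [mul_zero] at h
    simpa using! ENNReal.tendsto_ofReal h
  refine tendsto_of_tendsto_of_tendsto_of_le_of_le' tendsto_const_nhds hlim
    (Eventually.of_forall fun _ => zero_le) ?_
  filter_upwards [eventually_ge_atTop p] with q hpq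
  have hMq := ENNReal.tendsto_ofReal (hMlim q)
  rw [← hMq.limsup_eq]
  refine limsup_le_limsup ?_
  filter_upwards [eventually_ge_atTop 1] with n hn
  calc (n : ℝ≥0∞) * ∑ j ∈ Finset.Ico (q + 1) (n / k n),
        μ (exceedance f ψ u q n ∩ f^[j] ⁻¹' exceedance f ψ u q n)
      = ENNReal.ofReal (S q n) := by
        rw [hS, ENNReal.ofReal_mul n.cast_nonneg, ENNReal.ofReal_natCast,
          ENNReal.ofReal_sum_of_nonneg fun _ _ => measureReal_nonneg]
        simp only [ofReal_measureReal (measure_ne_top _ _)]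
    _ ≤ ENNReal.ofReal (M q n) := ENNReal.ofReal_le_ofReal (hSM q hpq n hn)

theorem tendsto_maxLE_of_indicatorDecay (hf : MeasurePreserving f μ μ)
    (hE : ∀ n, MeasurableSet (exceedance f ψ u 0 n))
    (hρ : ∀ n, 1 ≤ n → 0 ≤ ρ n) (hs : Summable ρ)
    (hdec : ∀ n, 1 ≤ n → IndicatorDecay μ f ρ (exceedance f ψ u p n))
    (hc : Tendsto (fun n : ℕ => (n : ℝ) * μ.real (exceedance f ψ u 0 n)) atTop (𝓝 c))
    (hret : Tendsto (fun n => firstReturn f (exceedance f ψ u p n)) atTop (𝓝 ⊤))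
    {θ : ℝ} (hθ : IsExtremalIndex μ f ψ u θ) :
    Tendsto (fun n => μ.real (maxLE f ψ u n)) atTop (𝓝 (Real.exp (-(θ * c)))) := by
  have hm : ∀ q n, MeasurableSet (exceedance f ψ u q n) := fun q n => by
    rw [exceedance_eq_escape]
    exact measurableSet_escape hf.measurable (hE n) q
  have hsub : ∀ {a b} n, a ≤ b → exceedance f ψ u b n ⊆ exceedance f ψ u a n := by
    intro a b n hab
    rw [exceedance_eq_escape, exceedance_eq_escape a]
    exact escape_anti _ hab
  have hret' := eventually_notMem_of_tendsto_firstReturn hret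
  obtain ⟨a, ha, haθ⟩ := hθ
  have hcp : ∀ᶠ q in atTop, Tendsto (fun n : ℕ => (n : ℝ) * μ.real (exceedance f ψ u p n))
      atTop (𝓝 (a q * c)) := by
    filter_upwards [ha, eventually_ge_atTop p] with q hq hpq
    have hdiff := tendsto_mul_escape_diff hf hE hc (p := p) (fun N => by
      simpa only [← exceedance_eq_escape] using hret' N) q
    simp only [← exceedance_eq_escape] at hdiff
    have h := (hq.mul hc).add hdiff
    rw [add_zero] at h
    refine h.congr fun n => ?_
    rw [measureReal_sdiff (hsub n hpq) (hm q n)]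
    -- The ratio in the extremal index is `0 / 0 = 0` here, but then both measures vanish.
    by_cases h0 : μ.real (exceedance f ψ u 0 n) = 0
    · have h1 : μ.real (exceedance f ψ u q n) = 0 := le_antisymm
        (h0 ▸ measureReal_mono (hsub n (Nat.zero_le q)) (measure_ne_top _ _)) measureReal_nonneg
      rw [h0, h1]; ring
    · field_simp
      ring
  obtain ⟨q₀, hq₀⟩ := hcp.exists
  -- One sequence has the limit `a q * c` for all large `q`, so these values agree and equal their
  -- limit `θ * c`.
  have hac : a q₀ * c = θ * c := by
    refine tendsto_nhds_unique ?_ (haθ.mul_const c)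
    exact tendsto_const_nhds.congr' (hcp.mono fun q hq => tendsto_nhds_unique hq₀ hq)
  rw [hac] at hq₀
  have hB := tendsto_avoid_exp hf (hm p) hρ hs hdec hq₀ hret'
  have hzero : Tendsto (fun n => μ.real (exceedance f ψ u 0 n)) atTop (𝓝 0) :=
    tendsto_zero_of_tendsto_nat_mul hc
  have hlow := hB.sub (hzero.const_mul (p : ℝ))
  rw [mul_zero, sub_zero] at hlow
  refine tendsto_of_tendsto_of_tendsto_of_le_of_le hlow hB (fun n => ?_) fun n => ?_
  · rw [maxLE_eq_avoid]
    set E := exceedance f ψ u 0 n with hEn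
    have h1 : μ.real (avoid f (escape f E p) 0 n) ≤ μ.real (avoid f E 0 n) +
        μ.real (⋃ i ∈ Finset.Ico (n - p) n, f^[i] ⁻¹' E) := by
      refine (measureReal_mono ?_ (measure_ne_top _ _)).trans (measureReal_union_le _ _)
      exact sdiff_subset_iff.1 (avoid_zero_diff_subset E p n)
    have h2 : μ.real (⋃ i ∈ Finset.Ico (n - p) n, f^[i] ⁻¹' E) ≤ p * μ.real E := by
      refine (measureReal_biUnion_finset_le _ _).trans ?_
      simp only [measureReal_preimage_iterate hf (hE n), Finset.sum_const, Nat.card_Ico,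
        nsmul_eq_mul, hEn]
      gcongr
      omega
    simp only [exceedance_eq_escape p, ← hEn]
    linarith
  · rw [maxLE_eq_avoid]
    refine measureReal_mono (fun x hx i hi h => hx i hi (hsub n (Nat.zero_le p) h))
      (measure_ne_top _ _)

end Exceedances

open scoped NNReal
open Asymptotics

/-! ### Measures of small balls -/

/-- The constant is `2` at interior points and `1` at the endpoints, where half of the ball is cut
off. -/
theorem exists_volume_ball_eq (ζ : I) : ∃ w : ℝ, 0 < w ∧
    ∀ᶠ r : ℝ≥0 in 𝓝 0, (volume : Measure I).real (Metric.ball ζ r) = w * r := by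
  have himage : ∀ r : ℝ≥0, (volume : Measure I).real (Metric.ball ζ r) =
      (volume : Measure ℝ).real (Ioo ((ζ : ℝ) - r) (ζ + r) ∩ Icc 0 1) := by
    intro r
    rw [measureReal_def, unitInterval.volume_apply, measureReal_def]
    congr 2
    ext x
    constructor
    · rintro ⟨y, hy, rfl⟩
      rw [Metric.mem_ball, Subtype.dist_eq, Real.dist_eq, abs_lt] at hy
      exact ⟨⟨by linarith, by linarith⟩, y.2⟩
    · rintro ⟨⟨h1, h2⟩, h3⟩
      refine ⟨⟨x, h3⟩, ?_, rfl⟩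
      rw [Metric.mem_ball, Subtype.dist_eq, Real.dist_eq, abs_lt]
      exact ⟨by linarith, by linarith⟩
  have hsmall : ∀ a : ℝ, 0 < a → ∀ᶠ r : ℝ≥0 in 𝓝 0, (r : ℝ) < a := fun a ha =>
    (NNReal.continuous_coe.tendsto 0).eventually (gt_mem_nhds (by simpa using ha))
  rcases ζ.2.1.eq_or_lt with h0 | h0
  · refine ⟨1, one_pos, (hsmall 1 one_pos).mono fun r hr => ?_⟩
    have : Ioo ((ζ : ℝ) - r) (ζ + r) ∩ Icc 0 1 = Ico 0 (r : ℝ) := by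
      ext x
      have := r.2
      simp only [mem_inter_iff, mem_Ioo, mem_Icc, mem_Ico]
      constructor
      · rintro ⟨⟨h1, h2⟩, h3, h4⟩
        exact ⟨h3, by linarith⟩
      · rintro ⟨h1, h2⟩
        exact ⟨⟨by linarith, by linarith⟩, h1, by linarith⟩
    rw [himage, this, Real.volume_real_Ico_of_le r.coe_nonneg]
    ring
  rcases ζ.2.2.eq_or_lt with h1 | h1
  · refine ⟨1, one_pos, (hsmall 1 one_pos).mono fun r hr => ?_⟩
    have : Ioo ((ζ : ℝ) - r) (ζ + r) ∩ Icc 0 1 = Ioc (1 - (r : ℝ)) 1 := by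
      ext x
      have := r.2
      simp only [mem_inter_iff, mem_Ioo, mem_Icc, mem_Ioc]
      constructor
      · rintro ⟨⟨h1, h2⟩, h3, h4⟩
        exact ⟨by linarith, h4⟩
      · rintro ⟨h1, h2⟩
        refine ⟨⟨by linarith, ?_⟩, by linarith, h2⟩
        have : (0 : ℝ) < r := by linarith
        linarith
    rw [himage, this, Real.volume_real_Ioc_of_le (by linarith [r.2])]
    ring
  · refine ⟨2, two_pos, ?_⟩
    filter_upwards [hsmall ζ h0, hsmall (1 - ζ) (by linarith)] with r hr hr'
    have : Ioo ((ζ : ℝ) - r) (ζ + r) ∩ Icc 0 1 = Ioo ((ζ : ℝ) - r) (ζ + r) :=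
      inter_eq_left.2 fun x hx => ⟨by linarith [hx.1], by linarith [hx.2]⟩
    rw [himage, this, Real.volume_real_Ioo_of_le (by linarith [r.2])]
    ring

theorem tendsto_ball_smallSets {X : Type*} [PseudoMetricSpace X] (ζ : X) :
    Tendsto (fun r : ℝ≥0 => Metric.ball ζ (r : ℝ)) (𝓝 0) (𝓝 ζ).smallSets := by
  rw [tendsto_smallSets_iff]
  intro t ht
  obtain ⟨ε, hε, hεt⟩ := Metric.mem_nhds_iff.1 ht
  have : ∀ᶠ r : ℝ≥0 in 𝓝 0, (r : ℝ) < ε :=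
    (NNReal.continuous_coe.tendsto 0).eventually (gt_mem_nhds (by simpa using hε))
  exact this.mono fun r hr => (Metric.ball_subset_ball hr.le).trans hεt

/-- Differentiation of the integral of the density at a point of continuity; `L` is the density at
`ζ` times the constant of `exists_volume_ball_eq`. -/
theorem exists_measureReal_ball_isLittleO {μ : Measure I} [IsProbabilityMeasure μ]
    {h : I → ℝ≥0∞} (hh : Measurable h) (hμ : μ = (volume : Measure I).withDensity h) {ζ : I}
    (hζ : ∃ U ∈ 𝓝 ζ, ContinuousOn h U ∧ ∀ x ∈ U, 0 < h x ∧ h x < ∞) :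
    ∃ L : ℝ, 0 < L ∧
      (fun r : ℝ≥0 => μ.real (Metric.ball ζ r) - L * r) =o[𝓝 0] fun r : ℝ≥0 => (r : ℝ) := by
  obtain ⟨U, hU, hcont, hpos⟩ := hζ
  obtain ⟨w, hw, hvol⟩ := exists_volume_ball_eq ζ
  have hζU := hpos ζ (mem_of_mem_nhds hU)
  have hfin : ∫⁻ x, h x ∂(volume : Measure I) ≠ ∞ := by
    have : μ univ = ∫⁻ x, h x ∂(volume : Measure I) := by
      rw [hμ, withDensity_apply _ MeasurableSet.univ, Measure.restrict_univ]
    rw [← this]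
    exact measure_ne_top _ _
  have hint : ∀ r : ℝ≥0, ∫ x in Metric.ball ζ (r : ℝ), (h x).toReal =
      μ.real (Metric.ball ζ r) := by
    intro r
    rw [integral_toReal hh.aemeasurable (ae_restrict_of_ae (ae_lt_top hh hfin)),
      measureReal_def, hμ, withDensity_apply _ Metric.isOpen_ball.measurableSet]
  have hc : ContinuousAt (fun x => (h x).toReal) ζ :=
    (ENNReal.tendsto_toReal hζU.2.ne).comp (hcont.continuousAt hU)
  have key := hc.integral_sub_linear_isLittleO_ae (μ := (volume : Measure I))
    hh.ennreal_toReal.stronglyMeasurable.stronglyMeasurableAtFilter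
    (tendsto_ball_smallSets ζ) (fun r : ℝ≥0 => w * (r : ℝ)) hvol
  refine ⟨w * (h ζ).toReal, mul_pos hw (ENNReal.toReal_pos hζU.1.ne' hζU.2.ne), ?_⟩
  refine ((isLittleO_const_mul_right_iff hw.ne').1 key).congr_left fun r => ?_
  rw [hint, smul_eq_mul]
  ring

/-! ### Sequences of radii -/

section Radii

variable {F : ℝ≥0 → ℝ} {L s : ℝ} {r : ℕ → ℝ≥0}

theorem tendsto_nat_mul_of_isLittleO
    (hF : (fun r : ℝ≥0 => F r - L * r) =o[𝓝 0] fun r : ℝ≥0 => (r : ℝ))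
    (hr : Tendsto (fun n : ℕ => (n : ℝ) * r n) atTop (𝓝 s)) :
    Tendsto (fun n : ℕ => (n : ℝ) * F (r n)) atTop (𝓝 (L * s)) := by
  have h1 := (isBigO_refl (fun n : ℕ => (n : ℝ)) atTop).mul_isLittleO
    (hF.comp_tendsto (NNReal.tendsto_coe.1 (tendsto_zero_of_tendsto_nat_mul hr)))
  have h2 : Tendsto (fun n : ℕ => (n : ℝ) * (F (r n) - L * r n)) atTop (𝓝 0) :=
    (isLittleO_one_iff ℝ).1 (h1.trans_isBigO (hr.isBigO_one ℝ))
  have h3 := h2.add (hr.const_mul L)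
  rw [zero_add] at h3
  exact h3.congr fun n => by ring

theorem tendsto_nat_mul_radius
    (hF : (fun r : ℝ≥0 => F r - L * r) =o[𝓝 0] fun r : ℝ≥0 => (r : ℝ)) (hL : 0 < L)
    (hr0 : Tendsto r atTop (𝓝 0))
    (hFr : Tendsto (fun n : ℕ => (n : ℝ) * F (r n)) atTop (𝓝 s)) :
    Tendsto (fun n : ℕ => (n : ℝ) * r n) atTop (𝓝 (s / L)) := by
  have h1 : (fun n => F (r n)) ~[atTop] fun n => L * (r n : ℝ) :=
    (isLittleO_const_mul_right_iff hL.ne').2 (hF.comp_tendsto hr0)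
  have h2 := ((IsEquivalent.refl (u := fun n : ℕ => (n : ℝ)) (l := atTop)).mul h1).tendsto_nhds hFr
  refine (h2.div_const L).congr fun n => ?_
  simp only [Pi.mul_apply]
  field_simp

end Radii

/-! ### Unions of small balls -/

section Balls

variable {X : Type*} [MetricSpace X] [MeasurableSpace X] [OpensMeasurableSpace X]
  {μ : Measure X} [IsProbabilityMeasure μ] {S : Finset X} {L : X → ℝ}

theorem eventually_measureReal_biUnion_ball {α : Type*} {l : Filter α} {R : α → X → ℝ≥0}
    (hR : ∀ ζ ∈ S, Tendsto (fun a => R a ζ) l (𝓝 0)) :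
    ∀ᶠ a in l, μ.real (⋃ ζ ∈ S, Metric.ball ζ (R a ζ)) =
      ∑ ζ ∈ S, μ.real (Metric.ball ζ (R a ζ)) := by
  obtain ⟨U, hU, hdisj⟩ := S.finite_toSet.t2_separation
  have hsub : ∀ᶠ a in l, ∀ ζ ∈ S, Metric.ball ζ (R a ζ : ℝ) ⊆ U ζ :=
    (eventually_all_finset S).2 fun ζ hζ =>
      tendsto_smallSets_iff.1 ((tendsto_ball_smallSets ζ).comp (hR ζ hζ)) _
        ((hU ζ).2.mem_nhds (hU ζ).1)
  filter_upwards [hsub] with a ha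
  exact measureReal_biUnion_finset (fun x hx y hy hxy => (hdisj hx hy hxy).mono (ha x hx) (ha y hy))
    fun _ _ => Metric.isOpen_ball.measurableSet

theorem tendsto_nat_mul_biUnion_ball
    (hL : ∀ ζ ∈ S, (fun r : ℝ≥0 => μ.real (Metric.ball ζ r) - L ζ * r) =o[𝓝 0]
      fun r : ℝ≥0 => (r : ℝ))
    {R : ℕ → X → ℝ≥0} {s : X → ℝ}
    (hR : ∀ ζ ∈ S, Tendsto (fun n : ℕ => (n : ℝ) * R n ζ) atTop (𝓝 (s ζ))) :
    Tendsto (fun n : ℕ => (n : ℝ) * μ.real (⋃ ζ ∈ S, Metric.ball ζ (R n ζ))) atTop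
      (𝓝 (∑ ζ ∈ S, L ζ * s ζ)) := by
  have h1 := tendsto_finsetSum S fun ζ hζ => tendsto_nat_mul_of_isLittleO (hL ζ hζ) (hR ζ hζ)
  refine h1.congr' ?_
  filter_upwards [eventually_measureReal_biUnion_ball (μ := μ) (S := S)
    fun ζ hζ => NNReal.tendsto_coe.1 (tendsto_zero_of_tendsto_nat_mul (hR ζ hζ))] with n hn
  rw [hn, Finset.mul_sum]

theorem biUnion_ball_isLittleO
    (hL : ∀ ζ ∈ S, (fun r : ℝ≥0 => μ.real (Metric.ball ζ r) - L ζ * r) =o[𝓝 0]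
      fun r : ℝ≥0 => (r : ℝ)) :
    (fun r : ℝ≥0 => μ.real (⋃ ζ ∈ S, Metric.ball ζ r) - (∑ ζ ∈ S, L ζ) * r) =o[𝓝 0]
      fun r : ℝ≥0 => (r : ℝ) := by
  refine (IsLittleO.sum hL).congr' ?_ EventuallyEq.rfl
  filter_upwards [eventually_measureReal_biUnion_ball (μ := μ) (S := S)
    (R := fun (r : ℝ≥0) _ => r) (l := 𝓝 0) fun ζ _ => tendsto_id] with r hr
  rw [hr, Finset.sum_apply, Finset.sum_sub_distrib, Finset.sum_mul]

/-- The linear growth at `0` makes `F` positive on positive radii, so by monotonicity radii bounded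
away from `0` would keep `F` away from `0`. This permits the local asymptotics for arbitrary
normalising levels. -/
theorem tendsto_radius_zero {F : ℝ≥0 → ℝ} {c : ℝ} (hmono : Monotone F)
    (hF : (fun r : ℝ≥0 => F r - c * r) =o[𝓝 0] fun r : ℝ≥0 => (r : ℝ)) (hc : 0 < c)
    {r : ℕ → ℝ≥0} {s : ℝ} (hs : Tendsto (fun n : ℕ => (n : ℝ) * F (r n)) atTop (𝓝 s)) :
    Tendsto r atTop (𝓝 0) := by
  have hFr : Tendsto (fun n => F (r n)) atTop (𝓝 0) :=
    tendsto_zero_of_tendsto_nat_mul hs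
  have hpos : ∀ ε : ℝ≥0, 0 < ε → 0 < F ε := by
    intro ε hε
    have h1 : ∀ᶠ r : ℝ≥0 in 𝓝[>] 0, ‖F r - c * r‖ ≤ c / 2 * ‖(r : ℝ)‖ :=
      (hF.def (half_pos hc)).filter_mono nhdsWithin_le_nhds
    have h2 : ∀ᶠ r : ℝ≥0 in 𝓝[>] 0, r < ε :=
      (gt_mem_nhds hε : ∀ᶠ r : ℝ≥0 in 𝓝 0, r < ε).filter_mono nhdsWithin_le_nhds
    obtain ⟨r, h1, h2, h3⟩ := (h1.and (h2.and self_mem_nhdsWithin)).exists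
    have h3' : (0 : ℝ) < r := by exact_mod_cast h3
    rw [Real.norm_eq_abs, Real.norm_eq_abs, abs_of_pos h3', abs_le] at h1
    have : 0 < F r := by nlinarith [h1.1, mul_pos hc h3']
    exact this.trans_le (hmono h2.le)
  refine tendsto_order.2 ⟨fun a ha => absurd ha not_lt_zero, fun ε hε => ?_⟩
  filter_upwards [hFr.eventually (gt_mem_nhds (hpos ε hε))] with n hn
  exact lt_of_not_ge fun hle => hn.not_ge (hmono hle)

end Balls

/-! ### Level sets of the observables -/

/-- The level that corresponds to distance `r` from the maximal set. -/
noncomputable def ObservableType.level : ObservableType → ℝ → ℝ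
  | .log, r => -Real.log r
  | .power α _, r => r ^ (-1 / α)
  | .bounded D α _, r => D - r ^ (1 / α)

theorem ObservableType.level_lt_g_iff (g : ObservableType) {r t : ℝ} (hr : 0 < r) (ht : 0 ≤ t) :
    (g.level r : EReal) < g.g t ↔ t < r := by
  cases g with
  | log =>
    by_cases h0 : t = 0
    · simp [ObservableType.g, h0, hr, EReal.coe_lt_top]
    · have ht' := ht.lt_of_ne' h0
      simp only [ObservableType.g, ObservableType.level, if_neg h0, EReal.coe_lt_coe_iff,
        neg_lt_neg_iff]
      exact Real.log_lt_log_iff ht' hr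
  | power α hα =>
    by_cases h0 : t = 0
    · simp [ObservableType.g, h0, hr, EReal.coe_lt_top]
    · have ht' := ht.lt_of_ne' h0
      simp only [ObservableType.g, ObservableType.level, if_neg h0, EReal.coe_lt_coe_iff]
      exact Real.rpow_lt_rpow_iff_of_neg hr ht' (div_neg_of_neg_of_pos (by norm_num) hα)
  | bounded D α hα =>
    simp only [ObservableType.g, ObservableType.level, EReal.coe_lt_coe_iff, sub_lt_sub_iff_left]
    exact Real.rpow_lt_rpow_iff ht hr.le (by positivity)

/-- Levels outside the range of `g` need care: a nonpositive level of the power type is always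
exceeded, and radius `2` covers all distances up to `1`; a level at or above `D` never is, and
radius `0` gives the empty ball. -/
theorem ObservableType.exists_radius (g : ObservableType) (u : ℝ) :
    ∃ r : ℝ≥0, ∀ t : ℝ, 0 ≤ t → t ≤ 1 → ((u : EReal) < g.g t ↔ t < r) := by
  have of_level : ∀ r : ℝ, 0 < r → g.level r = u →
      ∃ r : ℝ≥0, ∀ t : ℝ, 0 ≤ t → t ≤ 1 → ((u : EReal) < g.g t ↔ t < r) :=
    fun r hr h => ⟨⟨r, hr.le⟩, fun t ht _ => by rw [← h]; exact g.level_lt_g_iff hr ht⟩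
  cases g with
  | log => exact of_level (Real.exp (-u)) (Real.exp_pos _) (by simp [ObservableType.level])
  | power α hα =>
    rcases le_or_gt u 0 with hu | hu
    · refine ⟨2, fun t ht ht1 => iff_of_true ?_ (by push_cast; linarith)⟩
      by_cases h0 : t = 0
      · simp [ObservableType.g, h0, EReal.coe_lt_top]
      · simp only [ObservableType.g, if_neg h0, EReal.coe_lt_coe_iff]
        exact hu.trans_lt (Real.rpow_pos_of_pos (ht.lt_of_ne' h0) _)
    · refine of_level (u ^ (-α)) (Real.rpow_pos_of_pos hu _) ?_
      rw [ObservableType.level, ← Real.rpow_mul hu.le]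
      field_simp
      simp
  | bounded D α hα =>
    rcases le_or_gt D u with hu | hu
    · refine ⟨0, fun t ht _ => iff_of_false ?_ (by simpa using ht)⟩
      simp only [ObservableType.g, EReal.coe_lt_coe_iff, not_lt]
      linarith [Real.rpow_nonneg ht (1 / α)]
    · refine of_level ((D - u) ^ α) (Real.rpow_pos_of_pos (sub_pos.2 hu) _) ?_
      rw [ObservableType.level, ← Real.rpow_mul (sub_pos.2 hu).le, mul_one_div_cancel hα.ne',
        Real.rpow_one]
      ring

section Observables

variable {d : ℕ} {g : Fin d → ObservableType} {Z : Fin d → Finset I}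

theorem infDist_lt_iff_mem_biUnion {j : Fin d} (hZ : (Z j).Nonempty) (x : I) (r : ℝ) :
    Metric.infDist x (Z j : Set I) < r ↔ x ∈ ⋃ ζ ∈ Z j, Metric.ball ζ r := by
  rw [Metric.infDist_lt_iff (by exact_mod_cast hZ)]
  simp only [mem_iUnion, Metric.mem_ball, exists_prop, Finset.mem_coe]

theorem setOf_level_lt_observable {j : Fin d} (hZ : (Z j).Nonempty) {r : ℝ} (hr : 0 < r) :
    {x | ((g j).level r : EReal) < observable g Z j x} = ⋃ ζ ∈ Z j, Metric.ball ζ r := by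
  ext x
  rw [← infDist_lt_iff_mem_biUnion hZ]
  exact (g j).level_lt_g_iff hr Metric.infDist_nonneg

theorem exists_radius_observable (hZ : ∀ j, (Z j).Nonempty) (u : ℕ → Fin d → ℝ) :
    ∃ r : ℕ → Fin d → ℝ≥0, ∀ n j, {x | (u n j : EReal) < observable g Z j x} =
      ⋃ ζ ∈ Z j, Metric.ball ζ (r n j : ℝ) := by
  choose r hr using fun n j => (g j).exists_radius (u n j)
  refine ⟨r, fun n j => ?_⟩
  ext x
  rw [← infDist_lt_iff_mem_biUnion (hZ j)]
  refine hr n j _ Metric.infDist_nonneg ?_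
  obtain ⟨ζ, hζ⟩ := hZ j
  refine (Metric.infDist_le_dist_of_mem (Finset.mem_coe.2 hζ)).trans ?_
  rw [Subtype.dist_eq, Real.dist_eq, abs_le]
  have h1 := x.2
  have h2 := ζ.2
  exact ⟨by linarith [h1.1, h2.2], by linarith [h1.2, h2.1]⟩

theorem measurableSet_exceedance_zero {f : I → I} (hZ : ∀ j, (Z j).Nonempty)
    (u : ℕ → Fin d → ℝ) (n : ℕ) : MeasurableSet (exceedance f (observable g Z) u 0 n) := by
  obtain ⟨r, hr⟩ := exists_radius_observable (g := g) hZ u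
  rw [exceedance_zero, ofPred_exists]
  refine MeasurableSet.iUnion fun j => ?_
  rw [hr]
  exact (isOpen_biUnion fun _ _ => Metric.isOpen_ball).measurableSet

variable {μ : Measure I} [IsProbabilityMeasure μ] {L : I → ℝ}

theorem exists_isNormalising (hZ : ∀ j, (Z j).Nonempty) (hLpos : ∀ j, ∀ ζ ∈ Z j, 0 < L ζ)
    (hL : ∀ j, ∀ ζ ∈ Z j, (fun r : ℝ≥0 => μ.real (Metric.ball ζ r) - L ζ * r) =o[𝓝 0]
      fun r : ℝ≥0 => (r : ℝ)) {τ : Fin d → ℝ} (hτ : 0 ≤ τ) :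
    ∃ u : ℕ → Fin d → ℝ, IsNormalising μ (observable g Z) τ u := by
  have hc : ∀ j, 0 < ∑ ζ ∈ Z j, L ζ := fun j => Finset.sum_pos (hLpos j) (hZ j)
  set s : Fin d → ℝ := fun j => τ j / ∑ ζ ∈ Z j, L ζ with hs
  have hs0 : ∀ j, 0 ≤ s j := fun j => div_nonneg (hτ j) (hc j).le
  -- The extra `1 / (n + 1)` keeps the radius positive when `τ j = 0`, without changing the limit of
  -- `n * r n j`.
  set r : ℕ → Fin d → ℝ := fun n j => (s j + 1 / ((n : ℝ) + 1)) / ((n : ℝ) + 1) with hr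
  have hrpos : ∀ n j, 0 < r n j := fun n j =>
    div_pos (add_pos_of_nonneg_of_pos (hs0 j) (by positivity)) (by positivity)
  refine ⟨fun n j => (g j).level (r n j), fun j => ?_⟩
  simp only [setOf_level_lt_observable (hZ j) (hrpos _ j)]
  have hlim : Tendsto (fun n : ℕ => (n : ℝ) * r n j) atTop (𝓝 (s j)) := by
    have h1 := (tendsto_natCast_div_add_atTop (1 : ℝ)).mul
      (tendsto_one_div_add_atTop_nhds_zero_nat.const_add (s j))
    rw [one_mul, add_zero] at h1
    exact h1.congr fun n => by simp only [hr]; ring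
  have h := tendsto_nat_mul_of_isLittleO (biUnion_ball_isLittleO (hL j))
    (r := fun n => ⟨r n j, (hrpos n j).le⟩) hlim
  rwa [hs, mul_div_cancel₀ _ (hc j).ne'] at h

/-- The limit of `n μ(X_0 ≰ u_n(τ))`, where `L ζ` is the rate of growth of the measure of small
balls at `ζ`. -/
noncomputable def exceedanceRate (Z : Fin d → Finset I) (L : I → ℝ) (τ : Fin d → ℝ) : ℝ :=
  ∑ ζ ∈ Finset.univ.biUnion Z, L ζ * (Finset.univ.sup fun j =>
    if ζ ∈ Z j then (τ j / ∑ ξ ∈ Z j, L ξ).toNNReal else 0 : ℝ≥0)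

theorem tendsto_nat_mul_exceedance_zero {f : I → I} (hZ : ∀ j, (Z j).Nonempty)
    (hLpos : ∀ j, ∀ ζ ∈ Z j, 0 < L ζ)
    (hL : ∀ j, ∀ ζ ∈ Z j, (fun r : ℝ≥0 => μ.real (Metric.ball ζ r) - L ζ * r) =o[𝓝 0]
      fun r : ℝ≥0 => (r : ℝ)) {τ : Fin d → ℝ} {u : ℕ → Fin d → ℝ}
    (hu : IsNormalising μ (observable g Z) τ u) :
    Tendsto (fun n : ℕ => (n : ℝ) * μ.real (exceedance f (observable g Z) u 0 n)) atTop
      (𝓝 (exceedanceRate Z L τ)) := by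
  have hc : ∀ j, 0 < ∑ ζ ∈ Z j, L ζ := fun j => Finset.sum_pos (hLpos j) (hZ j)
  obtain ⟨r, hr⟩ := exists_radius_observable (g := g) hZ u
  have hradius : ∀ j, Tendsto (fun n : ℕ => (n : ℝ≥0) * r n j) atTop
      (𝓝 (τ j / ∑ ζ ∈ Z j, L ζ).toNNReal) := by
    intro j
    have huj := hu j
    simp only [hr] at huj
    have hmono : Monotone fun r : ℝ≥0 => μ.real (⋃ ζ ∈ Z j, Metric.ball ζ (r : ℝ)) :=
      fun a b hab => measureReal_mono
        (iUnion₂_mono fun ζ _ => Metric.ball_subset_ball (by exact_mod_cast hab))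
        (measure_ne_top _ _)
    have hF := biUnion_ball_isLittleO (hL j)
    have h := tendsto_real_toNNReal
      (tendsto_nat_mul_radius hF (hc j) (tendsto_radius_zero hmono hF (hc j) huj) huj)
    refine h.congr fun n => ?_
    rw [Real.toNNReal_mul n.cast_nonneg, Real.toNNReal_natCast, Real.toNNReal_coe]
  -- The maximal sets may overlap. Concentric balls at a shared point merge into the largest one, so
  -- grouping by points gives balls that are eventually disjoint.
  set R : ℕ → I → ℝ≥0 := fun n ζ => Finset.univ.sup fun j => if ζ ∈ Z j then r n j else 0 with hR
  have hset : ∀ n, exceedance f (observable g Z) u 0 n =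
      ⋃ ζ ∈ Finset.univ.biUnion Z, Metric.ball ζ (R n ζ : ℝ) := by
    intro n
    rw [exceedance_zero, ofPred_exists]
    simp only [hr]
    ext x
    simp only [mem_iUnion, Finset.mem_biUnion, Finset.mem_univ, true_and, Metric.mem_ball,
      exists_prop, ← coe_nndist, NNReal.coe_lt_coe, hR, Finset.lt_sup_iff]
    constructor
    · rintro ⟨j, ζ, hζ, h⟩
      exact ⟨ζ, ⟨j, hζ⟩, j, by rwa [if_pos hζ]⟩
    · rintro ⟨ζ, -, j, h⟩
      split_ifs at h with hζ
      · exact ⟨j, ζ, hζ, h⟩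
      · exact absurd h not_lt_zero
  simp only [hset]
  refine tendsto_nat_mul_biUnion_ball (L := L) (R := R)
    (s := fun ζ => ((Finset.univ.sup fun j =>
      if ζ ∈ Z j then (τ j / ∑ ξ ∈ Z j, L ξ).toNNReal else 0 : ℝ≥0) : ℝ)) ?_ ?_
  · intro ζ hζ
    obtain ⟨j, -, hj⟩ := Finset.mem_biUnion.1 hζ
    exact hL j ζ hj
  · intro ζ _
    have h : Tendsto (fun n : ℕ => (n : ℝ≥0) * R n ζ) atTop (𝓝 (Finset.univ.sup fun j =>
        if ζ ∈ Z j then (τ j / ∑ ξ ∈ Z j, L ξ).toNNReal else 0)) := by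
      simp only [hR, NNReal.mul_finset_sup]
      refine Tendsto.finset_sup_nhds_apply fun j _ => ?_
      split_ifs
      · exact hradius j
      · simp
    exact_mod_cast NNReal.tendsto_coe.2 h

end Observables

end MultivariateExtremes

theorem mainTheorem2
    (f : I → I) (μ : Measure I) [IsProbabilityMeasure μ] (hf : MeasurePreserving f μ μ)
    (h : I → ℝ≥0∞) (hh : Measurable h) (hμ : μ = (volume : Measure I).withDensity h)
    (C : Type*) [NormedAddCommGroup C] [NormedSpace ℝ C] [CompleteSpace C]
    (ι : C →ₗ[ℝ] Lp ℝ 1 μ) (hdecay : MultivariateExtremes.SummableDecay μ f ι)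
    (d : ℕ) (Z : Fin d → Finset I) (hZ : ∀ j, (Z j).Nonempty)
    (hfcont : ∀ j, ∀ ζ ∈ Z j, ∃ U ∈ 𝓝 ζ, ContinuousOn f U)
    (hdens : ∀ j, ∀ ζ ∈ Z j, ∃ U ∈ 𝓝 ζ, ContinuousOn h U ∧ ∀ x ∈ U, 0 < h x ∧ h x < ∞)
    (g : Fin d → MultivariateExtremes.ObservableType)
    (ψ : Fin d → I → EReal) (hψ : ψ = MultivariateExtremes.observable g Z) :
    ∃ Γhat : (Fin d → ℝ) → ℝ, ∀ τ : Fin d → ℝ, 0 ≤ τ → τ ≠ 0 →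
      (∃ u : ℕ → Fin d → ℝ, MultivariateExtremes.IsNormalising μ ψ τ u) ∧
      ∀ u : ℕ → Fin d → ℝ, MultivariateExtremes.IsNormalising μ ψ τ u →
        Tendsto (fun n : ℕ => (n : ℝ) * μ.real (MultivariateExtremes.exceedance f ψ u 0 n))
          atTop (𝓝 (Γhat τ)) ∧
        ∀ θ : ℝ, MultivariateExtremes.IsExtremalIndex μ f ψ u θ →
        ∀ p : ℕ,
          IsLeast {j : ℕ | Tendsto (fun n => MultivariateExtremes.firstReturn f
            (MultivariateExtremes.exceedance f ψ u j n)) atTop (𝓝 ⊤)} p →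
          MultivariateExtremes.BoundedIndicators μ ι
            (fun n => MultivariateExtremes.exceedance f ψ u p n) →
          (∃ t : ℕ → ℕ → ℕ, MultivariateExtremes.MixingCondition μ f ψ u t ∧
            MultivariateExtremes.ClusterSeparation μ f ψ u t) ∧
          Tendsto (fun n => μ.real (MultivariateExtremes.maxLE f ψ u n)) atTop
            (𝓝 (Real.exp (-(θ * Γhat τ)))) := by
  open MultivariateExtremes in
  subst hψ
  -- The rate must depend on the point alone, not on `j`, for one function `L` to serve overlapping
  -- maximal sets.
  have hball : ∀ ζ : I, ∃ L : ℝ, ∀ j, ζ ∈ Z j → 0 < L ∧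
      (fun r : NNReal => μ.real (Metric.ball ζ r) - L * r) =o[𝓝 0] fun r : NNReal => (r : ℝ) := by
    intro ζ
    by_cases hζ : ∃ j, ζ ∈ Z j
    · obtain ⟨j, hj⟩ := hζ
      obtain ⟨L, hL⟩ := exists_measureReal_ball_isLittleO hh hμ (hdens j ζ hj)
      exact ⟨L, fun _ _ => hL⟩
    · exact ⟨0, fun j hj => absurd ⟨j, hj⟩ hζ⟩
  choose L hL using hball
  refine ⟨exceedanceRate Z L, fun τ hτ _ => ⟨exists_isNormalising hZ (fun j ζ hζ => (hL ζ j hζ).1)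
    (fun j ζ hζ => (hL ζ j hζ).2) hτ, fun u hu => ?_⟩⟩
  have hc := tendsto_nat_mul_exceedance_zero (f := f) hZ (fun j ζ hζ => (hL ζ j hζ).1)
    (fun j ζ hζ => (hL ζ j hζ).2) hu
  refine ⟨hc, fun θ hθ p hp hbdd => ?_⟩
  have hE := measurableSet_exceedance_zero (f := f) (g := g) hZ u
  have hEp : ∀ n, MeasurableSet (exceedance f (observable g Z) u p n) := fun n => by
    rw [exceedance_eq_escape]
    exact measurableSet_escape hf.measurable (hE n) p
  obtain ⟨ρ, hρ, hs, hdec⟩ := hdecay.exists_indicatorDecay hf hEp hbdd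
  obtain ⟨t, k, ht1, hk, hkt, ht, hrt⟩ := exists_gaps (runningMin_nonneg hρ)
    (tendsto_nat_mul_runningMin hρ hs)
  exact ⟨⟨fun _ => t, mixingCondition_of_indicatorDecay hf hE hρ hdec hc hp.1 ht1 ht hrt,
    clusterSeparation_of_indicatorDecay hf hE hρ hs hdec hc hk hkt⟩,
    tendsto_maxLE_of_indicatorDecay hf hE hρ hs hdec hc hp.1 hθ⟩
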